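/- Let $r\ge 1$, let $\alpha_1,\dots,\alpha_r$ be positive real numbers with $\sum_{i=1}^r\alpha_i=1$ that are linearly independent over $\mathbb{Q}$, and let $\pi$ be the permutation of $\{1,\dots,r\}$ with $\pi(k)=r+1-k$. Put $I_k=\bigl[\sum_{i<k}\alpha_i,\ \sum_{i\le k}\alpha_i\bigr)$ and let $T:[0,1)\to[0,1)$ be the associated $r$-interval exchange transformation, i.e. the bijection $$T(x)=x+\sum_{j<\pi(k)}\alpha_{\pi^{-1}(j)}-\sum_{j<k}\alpha_j\qquad\text{for } x\in I_k .$$ Let $x_0\in[0,1)$, and let $u=(u_n)_{n\in\mathbb{Z}}$ be the bi-infinite word over $\{1,\dots,r\}$ coding the orbit of $x_0$: $u_n=k$ if and only if $T^n(x_0)\in I_k$. Let $\mathcal{C}(n)$ be the number of factors $u_iu_{i+1}\cdots u_{i+n-1}$ of $u$ of length $n$, let $\mathcal{P}(n)$ be the number of those factors that are palindromes, and put $\Delta\mathcal{C}(n)=\mathcal{C}(n+1)-\mathcal{C}(n)$. Then, for every integer $n\ge 0$, $$\mathcal{P}(n)=\begin{cases}1 & \text{if } n \text{ is even},\\ r &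 \text{if } n\text{ is odd,}\end{cases}\qquad\text{and}\qquad \mathcal{P}(n)+\mathcal{P}(n+1)=\Delta\mathcal{C}(n)+2 .$$ The same holds for the one-sided infinite word $(u_n)_{n\in\mathbb{N}}$, $\mathbb{N}=\{0,1,2,\dots\}$, in place of $u$. -/

import Mathlib

/-! ### Interval exchange transformations of `[0,1)` -/

namespace IntervalExchange

/-- The left end point of the `k`-th interval: the sum of `α i` over `i < k`. -/
noncomputable def leftEnd {r : ℕ} (α : Fin r → ℝ) (k : Fin r) : ℝ :=
  ∑ i ∈ Finset.Iio k, α i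

/-- The `k`-th interval `I_k = [∑_{i<k} α i, ∑_{i≤k} α i)`. -/
noncomputable def piece {r : ℕ} (α : Fin r → ℝ) (k : Fin r) : Set ℝ :=
  Set.Ico (∑ i ∈ Finset.Iio k, α i) (∑ i ∈ Finset.Iic k, α i)

theorem sum_Iic_eq {r : ℕ} (α : Fin r → ℝ) (k : Fin r) :
    ∑ i ∈ Finset.Iic k, α i = leftEnd α k + α k := by
  rw [leftEnd, ← Finset.Iio_insert k, Finset.sum_insert (by simp), add_comm]

theorem mem_piece_iff {r : ℕ} (α : Fin r → ℝ) (k : Fin r) (x : ℝ) :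
    x ∈ piece α k ↔ leftEnd α k ≤ x ∧ x < leftEnd α k + α k := by
  rw [piece, sum_Iic_eq, Set.mem_Ico, leftEnd]

theorem piece_subset {r : ℕ} {α : Fin r → ℝ} (hpos : ∀ k, 0 < α k) (hsum : ∑ k, α k = 1)
    (k : Fin r) : piece α k ⊆ Set.Ico 0 1 := by
  intro x hx
  have h0 : 0 ≤ ∑ i ∈ Finset.Iio k, α i := Finset.sum_nonneg fun i _ => (hpos i).le
  have h1 : ∑ i ∈ Finset.Iic k, α i ≤ ∑ i, α i :=
    Finset.sum_le_sum_of_subset_of_nonneg (Finset.subset_univ _) fun i _ _ => (hpos i).le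
  exact ⟨h0.trans hx.1, hx.2.trans_le (h1.trans hsum.le)⟩

/-- The intervals `I_k` partition `[0,1)`. -/
theorem existsUnique_piece {r : ℕ} {α : Fin r → ℝ} (hpos : ∀ k, 0 < α k)
    (hsum : ∑ k, α k = 1) (x : Set.Ico (0 : ℝ) 1) : ∃! k, (x : ℝ) ∈ piece α k := by
  have key : ∀ a b : Fin r, a < b → (x : ℝ) ∈ piece α a → (x : ℝ) ∈ piece α b → False := by
    intro a b hab ha hb
    have : ∑ i ∈ Finset.Iic a, α i ≤ ∑ i ∈ Finset.Iio b, α i :=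
      Finset.sum_le_sum_of_subset_of_nonneg
        (fun i hi => by
          simp only [Finset.mem_Iic, Finset.mem_Iio] at hi ⊢
          exact lt_of_le_of_lt hi hab)
        fun i _ _ => (hpos i).le
    exact absurd (ha.2.trans_le this) (not_lt.mpr hb.1)
  have hr : 0 < r := by
    rcases Nat.eq_zero_or_pos r with h | h
    · subst h; simp at hsum
    · exact h
  let s : Finset (Fin r) := Finset.univ.filter fun k => (x : ℝ) < ∑ i ∈ Finset.Iic k, α i
  have hs : s.Nonempty := by
    refine ⟨⟨r - 1, by omega⟩, ?_⟩
    have : (Finset.Iic (⟨r - 1, by omega⟩ : Fin r)) = Finset.univ := by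
      ext i
      simp only [Finset.mem_Iic, Finset.mem_univ, iff_true, Fin.le_def]
      have := i.2
      omega
    simp only [s, Finset.mem_filter, Finset.mem_univ, true_and, this, hsum]
    exact x.2.2
  have hmem := Finset.min'_mem s hs
  refine ⟨s.min' hs, ⟨?_, (Finset.mem_filter.mp hmem).2⟩, ?_⟩
  · by_contra hlt
    rw [not_le] at hlt
    set k := s.min' hs with hk
    rcases Nat.eq_zero_or_pos k.1 with h0 | h0
    · have : Finset.Iio k = ∅ := by
        ext i
        simp only [Finset.mem_Iio, Finset.notMem_empty, iff_false, Fin.lt_def]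
        omega
      rw [this, Finset.sum_empty] at hlt
      exact absurd x.2.1 (not_le.mpr hlt)
    · have hk2 := k.2
      let j : Fin r := ⟨k.1 - 1, by omega⟩
      have hj : Finset.Iic j = Finset.Iio k := by
        ext i
        simp only [Finset.mem_Iio, Finset.mem_Iic, Fin.lt_def, Fin.le_def, j]
        omega
      have hjs : j ∈ s := by
        simp only [s, Finset.mem_filter, Finset.mem_univ, true_and, hj]
        exact hlt
      have := Finset.min'_le s j hjs
      rw [← hk, Fin.le_def] at this
      simp only [j] at this
      omega
  · intro y hy
    rcases lt_trichotomy y (s.min' hs) with h | h | h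
    · have hys : y ∈ s := by
        simp only [s, Finset.mem_filter, Finset.mem_univ, true_and]
        exact hy.2
      exact absurd (Finset.min'_le s y hys) (not_le.mpr h)
    · exact h
    · exact (key _ _ h ⟨by
        by_contra hlt
        have h2 := (Finset.mem_filter.mp hmem).2
        have h3 : ∑ i ∈ Finset.Iic (s.min' hs), α i ≤ ∑ i ∈ Finset.Iio y, α i :=
          Finset.sum_le_sum_of_subset_of_nonneg
            (fun i hi => by
              simp only [Finset.mem_Iic, Finset.mem_Iio] at hi ⊢
              exact lt_of_le_of_lt hi h)
            fun i _ _ => (hpos i).le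
        exact absurd (h2.trans_le h3) (not_lt.mpr hy.1), (Finset.mem_filter.mp hmem).2⟩ hy).elim

/-- The letter of a point `x` of `[0,1)`: the index `k` of the interval `I_k` containing `x`. -/
noncomputable def letter {r : ℕ} (α : Fin r → ℝ) (hpos : ∀ k, 0 < α k)
    (hsum : ∑ k, α k = 1) (x : Set.Ico (0 : ℝ) 1) : Fin r :=
  (existsUnique_piece hpos hsum x).choose

theorem mem_piece_letter {r : ℕ} {α : Fin r → ℝ} (hpos : ∀ k, 0 < α k)
    (hsum : ∑ k, α k = 1) (x : Set.Ico (0 : ℝ) 1) :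
    (x : ℝ) ∈ piece α (letter α hpos hsum x) :=
  (existsUnique_piece hpos hsum x).choose_spec.1

theorem letter_eq_iff {r : ℕ} {α : Fin r → ℝ} (hpos : ∀ k, 0 < α k)
    (hsum : ∑ k, α k = 1) (x : Set.Ico (0 : ℝ) 1) (k : Fin r) :
    letter α hpos hsum x = k ↔ (x : ℝ) ∈ piece α k :=
  ⟨fun h => h ▸ mem_piece_letter hpos hsum x,
    fun h => (existsUnique_piece hpos hsum x).unique (mem_piece_letter hpos hsum x) h⟩

/-- The amount by which the interval exchange with lengths `α` and permutation `π` translates the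
interval `I_k`, namely `∑_{j < π(k)} α (π⁻¹ j) - ∑_{j < k} α j`. -/
noncomputable def shift {r : ℕ} (α : Fin r → ℝ) (π : Equiv.Perm (Fin r)) (k : Fin r) : ℝ :=
  ∑ j ∈ Finset.Iio (π k), α (π.symm j) - ∑ j ∈ Finset.Iio k, α j

/-- The exchange sends `I_k` into the `π(k)`-th interval of the permuted length vector. -/
theorem add_shift_mem {r : ℕ} {α : Fin r → ℝ} (π : Equiv.Perm (Fin r)) {k : Fin r} {x : ℝ}
    (hx : x ∈ piece α k) : x + shift α π k ∈ piece (fun j => α (π.symm j)) (π k) := by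
  rw [mem_piece_iff] at hx ⊢
  simp only [leftEnd, shift, Equiv.symm_apply_apply] at hx ⊢
  constructor <;> linarith [hx.1, hx.2]

/-- The interval exchange transformation `T(x) = x + ∑_{j < π(k)} α (π⁻¹ j) - ∑_{j < k} α j`
for `x ∈ I_k`, as a map of `[0,1)` to itself. -/
noncomputable def exchangeFun {r : ℕ} (α : Fin r → ℝ) (hpos : ∀ k, 0 < α k)
    (hsum : ∑ k, α k = 1) (π : Equiv.Perm (Fin r)) (x : Set.Ico (0 : ℝ) 1) :
    Set.Ico (0 : ℝ) 1 :=
  ⟨(x : ℝ) + shift α π (letter α hpos hsum x),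
    piece_subset (α := fun j => α (π.symm j)) (fun _ => hpos _)
      ((Equiv.sum_comp π.symm α).trans hsum) _ (add_shift_mem π (mem_piece_letter hpos hsum x))⟩

theorem exchangeFun_bijective {r : ℕ} (α : Fin r → ℝ) (hpos : ∀ k, 0 < α k)
    (hsum : ∑ k, α k = 1) (π : Equiv.Perm (Fin r)) :
    Function.Bijective (exchangeFun α hpos hsum π) := by
  have hpos' : ∀ k, 0 < (fun j => α (π.symm j)) k := fun _ => hpos _
  have hsum' : ∑ k, (fun j => α (π.symm j)) k = 1 := (Equiv.sum_comp π.symm α).trans hsum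
  constructor
  · intro x y hxy
    have hv : (x : ℝ) + shift α π (letter α hpos hsum x)
        = (y : ℝ) + shift α π (letter α hpos hsum y) := congrArg Subtype.val hxy
    have hx := add_shift_mem π (mem_piece_letter hpos hsum x)
    have hy := add_shift_mem π (mem_piece_letter hpos hsum y)
    rw [← hv] at hy
    have hk : π (letter α hpos hsum x) = π (letter α hpos hsum y) :=
      (existsUnique_piece hpos' hsum' (exchangeFun α hpos hsum π x)).unique hx hy
    have hk' := π.injective hk
    rw [hk'] at hv
    exact Subtype.ext (by linarith)
  · intro y
    obtain ⟨j, hj, -⟩ := existsUnique_piece hpos' hsum' y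
    have hx : (y : ℝ) - shift α π (π.symm j) ∈ piece α (π.symm j) := by
      rw [mem_piece_iff] at hj ⊢
      simp only [leftEnd, shift, Equiv.apply_symm_apply] at hj ⊢
      constructor <;> linarith [hj.1, hj.2]
    refine ⟨⟨_, piece_subset hpos hsum _ hx⟩, Subtype.ext ?_⟩
    have hl : letter α hpos hsum ⟨_, piece_subset hpos hsum _ hx⟩ = π.symm j :=
      (letter_eq_iff hpos hsum _ _).mpr hx
    simp only [exchangeFun, hl]
    ring

/-- The interval exchange transformation as a bijection of `[0,1)` onto itself. -/
noncomputable def exchange {r : ℕ} (α : Fin r → ℝ) (hpos : ∀ k, 0 < α k)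
    (hsum : ∑ k, α k = 1) (π : Equiv.Perm (Fin r)) : Equiv.Perm (Set.Ico (0 : ℝ) 1) :=
  Equiv.ofBijective (exchangeFun α hpos hsum π) (exchangeFun_bijective α hpos hsum π)

/-- The bi-infinite word coding the orbit of `x₀`: its `n`-th letter (`n ∈ ℤ`) is the index `k`
with `T^n(x₀) ∈ I_k`. -/
noncomputable def codingWord {r : ℕ} (α : Fin r → ℝ) (hpos : ∀ k, 0 < α k)
    (hsum : ∑ k, α k = 1) (π : Equiv.Perm (Fin r)) (x₀ : Set.Ico (0 : ℝ) 1) (n : ℤ) : Fin r :=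
  letter α hpos hsum ((exchange α hpos hsum π ^ n) x₀)

end IntervalExchange

/-! ### Factors and palindromes of infinite words

A one-sided infinite word is a function on `ℕ`, a bi-infinite word a function on `ℤ`;
the definitions below apply to both index sets. -/

namespace InfiniteWord

/-- The set of factors of length `n` of the word `u`. -/
def factors {ι A : Type*} [AddMonoidWithOne ι] (u : ι → A) (n : ℕ) : Set (Fin n → A) :=
  {w | ∃ i : ι, ∀ j : Fin n, w j = u (i + ((j : ℕ) : ι))}

/-- The factor complexity `C(n)`: the number of factors of length `n`. -/
noncomputable def factorComplexity {ι A : Type*} [AddMonoidWithOne ι] (u : ι → A) (n : ℕ) : ℕ :=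
  (factors u n).ncard

/-- The palindromic complexity `P(n)`: the number of factors of length `n` that equal their
mirror image. -/
noncomputable def palindromicComplexity {ι A : Type*} [AddMonoidWithOne ι] (u : ι → A)
    (n : ℕ) : ℕ :=
  {w ∈ factors u n | ∀ j : Fin n, w j = w j.rev}.ncard

/-- The first difference `ΔC(n) = C(n+1) - C(n)`, an integer. -/
noncomputable def factorDifference {ι A : Type*} [AddMonoidWithOne ι] (u : ι → A) (n : ℕ) : ℤ :=
  (factorComplexity u (n + 1) : ℤ) - (factorComplexity u n : ℤ)

end InfiniteWord

/-!
Let `T` be the interval exchange that reverses the order of the intervals, and let `a_k` be the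
left end point of `I_k`.

*Distinct orbits.* `T ^ n x - x` is an integral combination of the lengths, in which every step
lowers the coefficient of the first length or raises that of the last one. So rational
independence excludes periodic points if `r ≥ 2` (`pow_apply_ne_self`) and forbids the forward
orbit of an `a_j` to reach an `a_i ≠ 0` in a positive number of steps (`pow_leftPoint_ne`).

*Minimality* (Keane's argument, for `r ≥ 2`; one letter is trivial). Let `U` be the union of all
`T ^ k J`, `k ∈ ℤ`, for a half-open interval `J`. The left boundary points of `U` are carried to
left boundary points as long as `T`, or its inverse, is continuous there. An orbit of boundary
points that never meets a discontinuity would stay `ε`-separated although it is infinite; so it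
meets one in both time directions, against the distinct orbit property. So `U` has no left
boundary points; as it cannot be a proper initial segment either (near `1` the exchange is a
translation to the left), `U` is everything. The reflection `x ↦ 1 - x` conjugates `T` to its
inverse, so the same holds for left neighbourhoods, and compactness of `[0,1]` bounds the time
between visits to `J`. Therefore the forward orbit of every point visits `J`, and the factors of
either coding word are exactly the itineraries of all points of `[0,1)`.

*Complexity.* Each nonempty set of constant itinerary of length `n` has a leftmost point, which is
`0` or one of the `n (r - 1)` distinct points `T ^ (-j) a_i` with `j < n` and `a_i ≠ 0`; so there
are `n (r - 1) + 1` factors of length `n` (`ncard_range_itinerary`).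

*Palindromes.* By the reflection, the itinerary of `1 - T ^ n x` is the mirror image of that of
`x` when the orbit of `x` avoids the end points. The orbits of `1/2` and of the midpoints of the
`I_k` do so by a parity argument, and they are symmetric about the midpoint: they yield one
palindrome of every even length and `r` palindromes of every odd length. Conversely, the set of
points with a palindromic itinerary is convex and essentially symmetric, so its midpoint runs
through `1/2` or through the midpoint of an `I_k` halfway (`palindromes_even`, `palindromes_odd`).
-/

namespace IntervalExchange

variable {r : ℕ} {α : Fin r → ℝ} (hpos : ∀ k, 0 < α k) (hsum : ∑ k, α k = 1)

/-! ### The symmetric exchange -/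

/-- The interval exchange that reverses the order of the intervals. -/
noncomputable abbrev symExchange : Equiv.Perm (Set.Ico (0 : ℝ) 1) :=
  exchange α hpos hsum Fin.revPerm

theorem leftEnd_rev (k : Fin r) :
    leftEnd (fun j => α (Fin.rev j)) (Fin.rev k) = ∑ j ∈ Finset.Ioi k, α j := by
  refine Finset.sum_nbij' Fin.rev Fin.rev ?_ ?_ ?_ ?_ ?_ <;> simp [Fin.lt_rev_iff]

theorem leftEnd_add_sum_Ioi (k : Fin r) :
    leftEnd α k + α k + ∑ j ∈ Finset.Ioi k, α j = ∑ j, α j := by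
  rw [← sum_Iic_eq, ← Finset.sum_union]
  · congr 1
    ext i
    simp [le_or_gt]
  · rw [Finset.disjoint_left]
    intro i
    simp

theorem leftEnd_rev_eq (hsum : ∑ k, α k = 1) (k : Fin r) :
    leftEnd (fun j => α (Fin.rev j)) (Fin.rev k) = 1 - (leftEnd α k + α k) := by
  rw [leftEnd_rev, ← hsum, ← leftEnd_add_sum_Ioi k]
  ring

theorem shift_revPerm (hsum : ∑ k, α k = 1) (k : Fin r) :
    shift α Fin.revPerm k = 1 - leftEnd α k - (leftEnd α k + α k) := by
  have h := leftEnd_rev_eq hsum k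
  simp only [leftEnd] at h ⊢
  simp only [shift, Fin.revPerm_symm, Fin.revPerm_apply]
  rw [h]
  ring

theorem leftEnd_letter_le (x : Set.Ico (0 : ℝ) 1) : leftEnd α (letter α hpos hsum x) ≤ x :=
  ((mem_piece_iff _ _ _).mp (mem_piece_letter hpos hsum x)).1

theorem lt_leftEnd_letter_add (x : Set.Ico (0 : ℝ) 1) :
    x < leftEnd α (letter α hpos hsum x) + α (letter α hpos hsum x) :=
  ((mem_piece_iff _ _ _).mp (mem_piece_letter hpos hsum x)).2

theorem letter_eq_of_mem {x : Set.Ico (0 : ℝ) 1} {k : Fin r} (h₁ : leftEnd α k ≤ x)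
    (h₂ : x < leftEnd α k + α k) : letter α hpos hsum x = k :=
  (letter_eq_iff hpos hsum x k).mpr ((mem_piece_iff _ _ _).mpr ⟨h₁, h₂⟩)

theorem symExchange_apply (x : Set.Ico (0 : ℝ) 1) :
    (symExchange hpos hsum x : ℝ) = x + (1 - leftEnd α (letter α hpos hsum x)
      - (leftEnd α (letter α hpos hsum x) + α (letter α hpos hsum x))) := by
  rw [← shift_revPerm hsum]
  rfl

theorem symExchange_sub {x y : Set.Ico (0 : ℝ) 1}
    (h : letter α hpos hsum x = letter α hpos hsum y) :
    (symExchange hpos hsum y : ℝ) - symExchange hpos hsum x = y - x := by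
  rw [symExchange_apply, symExchange_apply, h]
  ring

theorem leftEnd_add_le (hpos : ∀ k, 0 < α k) {a b : Fin r} (h : a < b) :
    leftEnd α a + α a ≤ leftEnd α b := by
  rw [← sum_Iic_eq]
  refine Finset.sum_le_sum_of_subset_of_nonneg (fun i hi => ?_) fun i _ _ => (hpos i).le
  simp only [Finset.mem_Iic, Finset.mem_Iio] at hi ⊢
  exact lt_of_le_of_lt hi h

theorem leftEnd_of_val_eq_zero {k : Fin r} (h : (k : ℕ) = 0) : leftEnd α k = 0 := by
  refine Finset.sum_eq_zero fun i hi => ?_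
  rw [Finset.mem_Iio, Fin.lt_def] at hi
  omega

/-- Two points with different letters are separated by a left end point other than `0`. -/
theorem exists_leftEnd_of_letter_ne {x y : Set.Ico (0 : ℝ) 1} (hxy : (x : ℝ) ≤ y)
    (h : letter α hpos hsum x ≠ letter α hpos hsum y) :
    ∃ i : Fin r, 0 < (i : ℕ) ∧ (x : ℝ) < leftEnd α i ∧ leftEnd α i ≤ y := by
  have h₁ := leftEnd_letter_le hpos hsum x
  have h₂ := lt_leftEnd_letter_add hpos hsum x
  have h₃ := leftEnd_letter_le hpos hsum y
  have h₄ := lt_leftEnd_letter_add hpos hsum y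
  rcases lt_or_gt_of_ne h with hlt | hlt
  · exact ⟨_, lt_of_le_of_lt (Nat.zero_le _) hlt, h₂.trans_le (leftEnd_add_le hpos hlt), h₃⟩
  · have := leftEnd_add_le hpos hlt
    linarith

/-- The left end point of `I_k`, as a point of `[0,1)`. -/
noncomputable def leftPoint (k : Fin r) : Set.Ico (0 : ℝ) 1 :=
  ⟨leftEnd α k, piece_subset hpos hsum k
    ((mem_piece_iff _ _ _).mpr ⟨le_rfl, lt_add_of_pos_right _ (hpos k)⟩)⟩

@[simp] theorem coe_leftPoint (k : Fin r) : (leftPoint hpos hsum k : ℝ) = leftEnd α k := rfl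

theorem letter_leftPoint (k : Fin r) : letter α hpos hsum (leftPoint hpos hsum k) = k :=
  letter_eq_of_mem hpos hsum le_rfl (lt_add_of_pos_right _ (hpos k))

theorem symExchange_leftPoint (k : Fin r) :
    (symExchange hpos hsum (leftPoint hpos hsum k) : ℝ) = 1 - (leftEnd α k + α k) := by
  rw [symExchange_apply, letter_leftPoint, coe_leftPoint]
  ring

/-- The symmetric exchange is inverted by reading the lengths backwards. -/
theorem symExchange_rev (hpos' : ∀ k, 0 < α (Fin.rev k)) (hsum' : ∑ k, α (Fin.rev k) = 1) :
    symExchange (α := fun k => α (Fin.rev k)) hpos' hsum' = (symExchange hpos hsum)⁻¹ := by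
  rw [eq_inv_iff_mul_eq_one]
  ext x
  rw [Equiv.Perm.mul_apply, symExchange_apply]
  set k := letter α hpos hsum x with hk
  have h₁ := leftEnd_letter_le hpos hsum x
  have h₂ := lt_leftEnd_letter_add hpos hsum x
  have h₃ := symExchange_apply hpos hsum x
  have h₄ := leftEnd_rev_eq hsum k
  rw [← hk] at h₁ h₂ h₃
  have h₅ : letter (fun k => α (Fin.rev k)) hpos' hsum' (symExchange hpos hsum x) = Fin.rev k := by
    apply letter_eq_of_mem
    · rw [h₃, h₄]; linarith
    · rw [h₃, h₄, Fin.rev_rev]; linarith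
  rw [h₅, h₃, h₄, Fin.rev_rev]
  simp only [Equiv.Perm.coe_one, id_eq]
  ring

/-! ### Orbits that stay in the same intervals -/

/-- As long as two points have the same letters, the exchange translates them together. -/
theorem pow_sub_pow_of_letter_eq {x y : Set.Ico (0 : ℝ) 1} {n : ℕ}
    (h : ∀ j < n, letter α hpos hsum ((symExchange hpos hsum ^ j) x)
      = letter α hpos hsum ((symExchange hpos hsum ^ j) y)) :
    ((symExchange hpos hsum ^ n) y : ℝ) - (symExchange hpos hsum ^ n) x = y - x := by
  induction n with
  | zero => simp
  | succ n ih =>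
    rw [pow_succ', Equiv.Perm.mul_apply, Equiv.Perm.mul_apply,
      symExchange_sub hpos hsum (h n n.lt_succ_self)]
    exact ih fun j hj => h j (hj.trans n.lt_succ_self)

/-- The set of points with a prescribed coding of length `n` is convex. -/
theorem letter_pow_eq_of_mem_Icc {x y z : Set.Ico (0 : ℝ) 1} {n : ℕ}
    (h : ∀ j < n, letter α hpos hsum ((symExchange hpos hsum ^ j) x)
      = letter α hpos hsum ((symExchange hpos hsum ^ j) y))
    (hxz : (x : ℝ) ≤ z) (hzy : (z : ℝ) ≤ y) :
    ∀ j < n, letter α hpos hsum ((symExchange hpos hsum ^ j) x)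
      = letter α hpos hsum ((symExchange hpos hsum ^ j) z) := by
  intro j
  induction j using Nat.strong_induction_on with
  | _ j ih =>
    intro hj
    have h₁ := pow_sub_pow_of_letter_eq hpos hsum fun i hi => h i (hi.trans hj)
    have h₂ := pow_sub_pow_of_letter_eq hpos hsum fun i hi => ih i hi (hi.trans hj)
    have h₃ := leftEnd_letter_le hpos hsum ((symExchange hpos hsum ^ j) x)
    have h₄ := lt_leftEnd_letter_add hpos hsum ((symExchange hpos hsum ^ j) y)
    rw [← h j hj] at h₄
    exact (letter_eq_of_mem hpos hsum (by linarith) (by linarith)).symm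

/-- Points close to `x` on its right have the same coding of length `n` as `x`. -/
theorem exists_letter_pow_eq (x : Set.Ico (0 : ℝ) 1) (n : ℕ) :
    ∃ δ > 0, (x : ℝ) + δ ≤ 1 ∧ ∀ y : Set.Ico (0 : ℝ) 1, (x : ℝ) ≤ y → (y : ℝ) < x + δ →
      ∀ j < n, letter α hpos hsum ((symExchange hpos hsum ^ j) x)
        = letter α hpos hsum ((symExchange hpos hsum ^ j) y) := by
  induction n with
  | zero => exact ⟨1 - x, by linarith [x.2.2], by linarith, by simp⟩
  | succ n ih =>
    obtain ⟨δ, hδ, hx, h⟩ := ih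
    set k := letter α hpos hsum ((symExchange hpos hsum ^ n) x) with hk
    have h₁ := leftEnd_letter_le hpos hsum ((symExchange hpos hsum ^ n) x)
    have h₂ := lt_leftEnd_letter_add hpos hsum ((symExchange hpos hsum ^ n) x)
    rw [← hk] at h₁ h₂
    refine ⟨min δ (leftEnd α k + α k - (symExchange hpos hsum ^ n) x),
      lt_min hδ (by linarith), (add_le_add_right (min_le_left _ _) _).trans hx,
      fun y hxy hy j hj => ?_⟩
    have hy₁ := hy.trans_le (add_le_add_right (min_le_left _ _) _)
    have hy₂ := hy.trans_le (add_le_add_right (min_le_right _ _) _)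
    rcases Nat.lt_succ_iff_lt_or_eq.mp hj with hj | rfl
    · exact h y hxy hy₁ j hj
    · have h₃ := pow_sub_pow_of_letter_eq hpos hsum (h y hxy hy₁)
      exact (letter_eq_of_mem hpos hsum (by linarith) (by linarith)).symm

/-- Every integer power of the exchange is a translation on a right neighbourhood of each
point. -/
theorem exists_zpow_eq_add (x : Set.Ico (0 : ℝ) 1) (k : ℤ) :
    ∃ δ > 0, ∀ y : Set.Ico (0 : ℝ) 1, (x : ℝ) ≤ y → (y : ℝ) < x + δ →
      ((symExchange hpos hsum ^ k) y : ℝ) = (symExchange hpos hsum ^ k) x + (y - x) := by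
  obtain ⟨n, rfl | rfl⟩ := k.eq_nat_or_neg
  · obtain ⟨δ, hδ, -, h⟩ := exists_letter_pow_eq hpos hsum x n
    refine ⟨δ, hδ, fun y h₁ h₂ => ?_⟩
    have := pow_sub_pow_of_letter_eq hpos hsum (h y h₁ h₂)
    rw [zpow_natCast]
    linarith
  · set x' := (symExchange hpos hsum ^ (-(n : ℤ))) x with hx'
    have hxx' : (symExchange hpos hsum ^ n) x' = x := by
      rw [hx', zpow_neg, zpow_natCast, Equiv.Perm.coe_inv, Equiv.apply_symm_apply]
    obtain ⟨δ, hδ, hle, h⟩ := exists_letter_pow_eq hpos hsum x' n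
    refine ⟨δ, hδ, fun y h₁ h₂ => ?_⟩
    let z : Set.Ico (0 : ℝ) 1 := ⟨x' + (y - x), by linarith [x'.2.1], by linarith⟩
    have hz := pow_sub_pow_of_letter_eq hpos hsum (h z (by simp [z, h₁]) (by simp only [z]; linarith))
    rw [hxx'] at hz
    have hzy : (symExchange hpos hsum ^ n) z = y := Subtype.ext (by simp only [z] at hz ⊢; linarith)
    rw [zpow_neg, zpow_natCast, ← hzy, Equiv.Perm.coe_inv, Equiv.symm_apply_apply]
    linarith

/-! ### Displacements and linear independence -/

/-- The coefficient of the length `α l` in the translation of the interval `I_k`. -/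
def shiftCoeff (k l : Fin r) : ℤ := (if k < l then 1 else 0) - (if l < k then 1 else 0)

theorem leftEnd_eq_sum_ite (k : Fin r) :
    leftEnd α k = ∑ l, ((if l < k then 1 else 0 : ℤ) : ℝ) * α l := by
  simp only [leftEnd, Int.cast_ite, Int.cast_one, Int.cast_zero, ite_mul, one_mul, zero_mul]
  rw [← Finset.sum_filter]
  congr 1
  ext i
  simp

theorem shift_eq_sum_shiftCoeff (hsum : ∑ k, α k = 1) (k : Fin r) :
    1 - leftEnd α k - (leftEnd α k + α k) = ∑ l, (shiftCoeff k l : ℝ) * α l := by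
  have h : ∑ l, ((if k < l then 1 else 0 : ℤ) : ℝ) * α l = ∑ j ∈ Finset.Ioi k, α j := by
    simp only [Int.cast_ite, Int.cast_one, Int.cast_zero, ite_mul, one_mul, zero_mul]
    rw [← Finset.sum_filter]
    congr 1
    ext i
    simp
  have h₂ := leftEnd_add_sum_Ioi (α := α) k
  simp only [shiftCoeff, Int.cast_sub, sub_mul, Finset.sum_sub_distrib]
  rw [h, ← leftEnd_eq_sum_ite]
  linarith

/-- The coefficient of `α l` in the displacement of `x` after `n` steps. -/
noncomputable def displacement (x : Set.Ico (0 : ℝ) 1) (n : ℕ) (l : Fin r) : ℤ :=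
  ∑ m ∈ Finset.range n, shiftCoeff (letter α hpos hsum ((symExchange hpos hsum ^ m) x)) l

theorem pow_apply_sub (x : Set.Ico (0 : ℝ) 1) (n : ℕ) :
    ((symExchange hpos hsum ^ n) x : ℝ) - x
      = ∑ l, (displacement hpos hsum x n l : ℝ) * α l := by
  induction n with
  | zero => simp [displacement]
  | succ n ih =>
    have h : ∀ l, (displacement hpos hsum x (n + 1) l : ℝ) * α l
        = displacement hpos hsum x n l * α l
          + shiftCoeff (letter α hpos hsum ((symExchange hpos hsum ^ n) x)) l * α l := by
      intro l
      rw [displacement, Finset.sum_range_succ, Int.cast_add, add_mul, displacement]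
    simp only [h]
    rw [Finset.sum_add_distrib, ← ih, ← shift_eq_sum_shiftCoeff hsum, pow_succ',
      Equiv.Perm.mul_apply, symExchange_apply]
    ring

theorem exists_zpow_apply_sub (x : Set.Ico (0 : ℝ) 1) (k : ℤ) :
    ∃ c : Fin r → ℤ, ((symExchange hpos hsum ^ k) x : ℝ) - x = ∑ l, (c l : ℝ) * α l := by
  obtain ⟨n, rfl | rfl⟩ := k.eq_nat_or_neg
  · exact ⟨_, by rw [zpow_natCast]; exact pow_apply_sub hpos hsum x n⟩
  · set y := (symExchange hpos hsum ^ (-(n : ℤ))) x with hy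
    have hxy : (symExchange hpos hsum ^ n) y = x := by
      rw [hy, zpow_neg, zpow_natCast, Equiv.Perm.coe_inv, Equiv.apply_symm_apply]
    have h := pow_apply_sub hpos hsum y n
    rw [hxy] at h
    refine ⟨fun l => -displacement hpos hsum y n l, ?_⟩
    simp only [Int.cast_neg, neg_mul, Finset.sum_neg_distrib]
    linarith

theorem eq_of_sum_intCast_mul_eq (hindep : LinearIndependent ℚ α) {c d : Fin r → ℤ}
    (h : ∑ l, (c l : ℝ) * α l = ∑ l, (d l : ℝ) * α l) (l : Fin r) : c l = d l := by
  have h₁ : ∑ l, ((c l - d l : ℤ) : ℚ) • α l = 0 := by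
    simp only [Rat.smul_def, Rat.cast_intCast]
    simp only [Int.cast_sub, sub_mul, Finset.sum_sub_distrib]
    rw [h, sub_self]
  have := Fintype.linearIndependent_iff.mp hindep _ h₁ l
  rw [Int.cast_eq_zero] at this
  omega

/-- No step raises the coefficient of the first length or lowers that of the last one, and every
step changes at least one of the two. -/
theorem displacement_first_neg_or_last_pos (x : Set.Ico (0 : ℝ) 1) {n : ℕ} (hn : 0 < n)
    {a b : Fin r} (ha : (a : ℕ) = 0) (hb : (b : ℕ) + 1 = r) (hab : a ≠ b) :
    displacement hpos hsum x n a < 0 ∨ 0 < displacement hpos hsum x n b := by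
  have h₁ : ∀ k : Fin r, shiftCoeff k a ≤ 0 := fun k => by
    have : ¬ k < a := by rw [Fin.lt_def]; omega
    simp only [shiftCoeff, if_neg this]
    split_ifs <;> simp
  have h₂ : ∀ k : Fin r, 0 ≤ shiftCoeff k b := fun k => by
    have : ¬ b < k := by rw [Fin.lt_def]; omega
    simp only [shiftCoeff, if_neg this]
    split_ifs <;> simp
  by_cases hk : letter α hpos hsum ((symExchange hpos hsum ^ 0) x) = a
  · right
    refine Finset.sum_pos' (fun m _ => h₂ _) ⟨0, Finset.mem_range.mpr hn, ?_⟩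
    have hlt : a < b := by
      have : (a : ℕ) ≠ b := fun h => hab (Fin.ext h)
      rw [Fin.lt_def]; omega
    rw [hk, shiftCoeff, if_pos hlt, if_neg hlt.not_gt]
    norm_num
  · left
    refine Finset.sum_neg' (fun m _ => h₁ _) ⟨0, Finset.mem_range.mpr hn, ?_⟩
    have hlt : a < letter α hpos hsum ((symExchange hpos hsum ^ 0) x) := by
      have : (a : ℕ) ≠ letter α hpos hsum ((symExchange hpos hsum ^ 0) x) :=
        fun h => hk (Fin.ext h.symm)
      rw [Fin.lt_def]; omega
    rw [shiftCoeff, if_pos hlt, if_neg hlt.not_gt]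
    norm_num

/-- Rational independence excludes periodic points. -/
theorem pow_apply_ne_self (hindep : LinearIndependent ℚ α) (hr : 2 ≤ r) (x : Set.Ico (0 : ℝ) 1)
    {n : ℕ} (hn : 0 < n) : (symExchange hpos hsum ^ n) x ≠ x := by
  intro h
  have h₁ := pow_apply_sub hpos hsum x n
  rw [h, sub_self] at h₁
  have h₂ := eq_of_sum_intCast_mul_eq hindep (c := displacement hpos hsum x n) (d := 0)
    (by rw [← h₁]; simp)
  have h₃ := displacement_first_neg_or_last_pos hpos hsum x hn (a := ⟨0, by omega⟩)
    (b := ⟨r - 1, by omega⟩) rfl (by simp; omega) (by simp; omega)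
  rw [h₂, h₂] at h₃
  simp at h₃

/-- The infinite distinct orbit condition: the forward orbit of a left end point never
reaches a left end point other than `0` again. -/
theorem pow_leftPoint_ne (hindep : LinearIndependent ℚ α) (j i : Fin r) (hi : 0 < (i : ℕ))
    {n : ℕ} (hn : 0 < n) :
    ((symExchange hpos hsum ^ n) (leftPoint hpos hsum j) : ℝ) ≠ leftEnd α i := by
  intro h
  have h₁ := pow_apply_sub hpos hsum (leftPoint hpos hsum j) n
  rw [h, coe_leftPoint, leftEnd_eq_sum_ite i, leftEnd_eq_sum_ite j, ← Finset.sum_sub_distrib] at h₁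
  have h₂ := eq_of_sum_intCast_mul_eq hindep
    (c := fun l => (if l < i then 1 else 0) - (if l < j then 1 else 0))
    (d := displacement hpos hsum (leftPoint hpos hsum j) n)
    (by rw [← h₁]; simp only [Int.cast_sub, sub_mul])
  have hr := i.2
  have h₃ := displacement_first_neg_or_last_pos hpos hsum (leftPoint hpos hsum j) hn
    (a := ⟨0, by omega⟩) (b := ⟨r - 1, by omega⟩) rfl (by simp; omega) (by simp; omega)
  rw [← h₂, ← h₂] at h₃
  have h₄ : (⟨0, by omega⟩ : Fin r) < i := by rw [Fin.lt_def]; exact hi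
  have h₅ : ¬ (⟨r - 1, by omega⟩ : Fin r) < i := by rw [Fin.lt_def]; simp; omega
  have h₆ : ¬ (⟨r - 1, by omega⟩ : Fin r) < j := by rw [Fin.lt_def]; simp; omega
  rw [if_pos h₄, if_neg h₅, if_neg h₆] at h₃
  split_ifs at h₃ <;> simp at h₃

/-! ### Boundary points of invariant sets -/

/-- A left boundary point `p` of `U`: a punctured right neighbourhood of `p` lies in `U`, while
every half-open interval `(p - δ, p]` contains points outside `U`. Such a point may or may not
belong to `U`. -/
def IsLeftBoundary (U : Set (Set.Ico (0 : ℝ) 1)) (p : Set.Ico (0 : ℝ) 1) : Prop :=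
  (∃ δ > 0, ∀ y : Set.Ico (0 : ℝ) 1, (p : ℝ) < y → (y : ℝ) < p + δ → y ∈ U) ∧
    ∀ δ > 0, ∃ y : Set.Ico (0 : ℝ) 1, (p : ℝ) - δ < y ∧ (y : ℝ) ≤ p ∧ y ∉ U

/-- If a set does not contain a whole left neighbourhood of `p`, including `p`, then the same is
true at the image of `p` under the exchange, unless the exchange is discontinuous at `p`. -/
theorem exists_notMem_left_of_symExchange {U : Set (Set.Ico (0 : ℝ) 1)}
    (hU : ∀ x, symExchange hpos hsum x ∈ U ↔ x ∈ U) {p : Set.Ico (0 : ℝ) 1}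
    (hp : ∀ i : Fin r, 0 < (i : ℕ) → (p : ℝ) ≠ leftEnd α i)
    (h : ∀ δ > 0, ∃ y : Set.Ico (0 : ℝ) 1, (p : ℝ) - δ < y ∧ (y : ℝ) ≤ p ∧ y ∉ U) :
    ∀ δ > 0, ∃ y : Set.Ico (0 : ℝ) 1, (symExchange hpos hsum p : ℝ) - δ < y ∧
      (y : ℝ) ≤ symExchange hpos hsum p ∧ y ∉ U := by
  intro δ hδ
  set k := letter α hpos hsum p with hk
  have h₁ := leftEnd_letter_le hpos hsum p
  have h₂ := lt_leftEnd_letter_add hpos hsum p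
  rw [← hk] at h₁ h₂
  rcases h₁.eq_or_lt with h₁ | h₁
  · have hk0 : (k : ℕ) = 0 := by
      by_contra h0
      exact hp k (Nat.pos_of_ne_zero h0) h₁.symm
    rw [leftEnd_of_val_eq_zero hk0] at h₁
    obtain ⟨y, -, hy, hyU⟩ := h 1 one_pos
    have : y = p := Subtype.ext (le_antisymm hy (h₁ ▸ y.2.1))
    rw [this] at hyU
    exact ⟨_, by linarith, le_rfl, (hU p).not.mpr hyU⟩
  · obtain ⟨y, hy₁, hy₂, hyU⟩ := h (min δ (p - leftEnd α k)) (lt_min hδ (by linarith))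
    have hδ₁ := min_le_left δ (p - leftEnd α k)
    have hδ₂ := min_le_right δ (p - leftEnd α k)
    have hy : letter α hpos hsum y = k :=
      letter_eq_of_mem hpos hsum (by linarith) (by linarith)
    have := symExchange_sub hpos hsum (hy.trans hk)
    exact ⟨_, by linarith, by linarith, (hU y).not.mpr hyU⟩

/-- A punctured right neighbourhood of `p` that is contained in `U` and meets no discontinuity is
translated into `U`. -/
theorem mem_right_of_symExchange {U : Set (Set.Ico (0 : ℝ) 1)}
    (hU : ∀ x, symExchange hpos hsum x ∈ U ↔ x ∈ U) {p : Set.Ico (0 : ℝ) 1} {ε : ℝ}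
    (hε : (p : ℝ) + ε ≤ 1)
    (hp : ∀ i : Fin r, 0 < (i : ℕ) → (p : ℝ) < leftEnd α i → (p : ℝ) + ε ≤ leftEnd α i)
    (h : ∀ y : Set.Ico (0 : ℝ) 1, (p : ℝ) < y → (y : ℝ) < p + ε → y ∈ U) :
    (symExchange hpos hsum p : ℝ) + ε ≤ 1 ∧
      ∀ y : Set.Ico (0 : ℝ) 1, (symExchange hpos hsum p : ℝ) < y →
        (y : ℝ) < symExchange hpos hsum p + ε → y ∈ U := by
  have key : ∀ t, 0 < t → t < ε → ∃ x : Set.Ico (0 : ℝ) 1, (x : ℝ) = p + t ∧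
      (symExchange hpos hsum x : ℝ) = symExchange hpos hsum p + t := by
    intro t ht htε
    let x : Set.Ico (0 : ℝ) 1 := ⟨p + t, by linarith [p.2.1], by linarith⟩
    have hx : (x : ℝ) = p + t := rfl
    refine ⟨x, hx, ?_⟩
    have hl : letter α hpos hsum p = letter α hpos hsum x := by
      by_contra hne
      obtain ⟨i, hi, h₁, h₂⟩ := exists_leftEnd_of_letter_ne hpos hsum (by linarith) hne
      linarith [hp i hi h₁]
    have := symExchange_sub hpos hsum hl
    linarith
  refine ⟨?_, fun y hy₁ hy₂ => ?_⟩
  · by_contra hlt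
    obtain ⟨x, -, hx⟩ := key (1 - symExchange hpos hsum p)
      (by linarith [(symExchange hpos hsum p).2.2]) (by linarith)
    linarith [(symExchange hpos hsum x).2.2]
  · obtain ⟨x, hx₁, hx₂⟩ := key (y - symExchange hpos hsum p) (by linarith) (by linarith)
    have hxy : symExchange hpos hsum x = y := Subtype.ext (by linarith)
    rw [← hxy, hU]
    exact h x (by linarith) (by linarith)

/-- The forward orbit of a left boundary point of an invariant set reaches a discontinuity.
Otherwise all points of the orbit are left boundary points with a right neighbourhood of a common
size `ε` in the set, so no two of them are closer than `ε`; but the orbit is infinite. -/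
theorem IsLeftBoundary.exists_pow_eq_leftEnd (hindep : LinearIndependent ℚ α) (hr : 2 ≤ r)
    {U : Set (Set.Ico (0 : ℝ) 1)} (hU : ∀ x, symExchange hpos hsum x ∈ U ↔ x ∈ U)
    {p : Set.Ico (0 : ℝ) 1} (hp : IsLeftBoundary U p) :
    ∃ (n : ℕ) (i : Fin r), 0 < (i : ℕ) ∧
      ((symExchange hpos hsum ^ n) p : ℝ) = leftEnd α i := by
  by_contra! hne
  obtain ⟨⟨δ, hδ, hright⟩, hleft⟩ := hp
  have hs : ∀ i : Fin r, ∃ s > 0,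
      (∃ s > 0, ∀ y : Set.Ico (0 : ℝ) 1, leftEnd α i - s < y → (y : ℝ) < leftEnd α i → y ∈ U) →
        ∀ y : Set.Ico (0 : ℝ) 1, leftEnd α i - s < y → (y : ℝ) < leftEnd α i → y ∈ U := by
    intro i
    by_cases h : ∃ s > 0, ∀ y : Set.Ico (0 : ℝ) 1,
        leftEnd α i - s < y → (y : ℝ) < leftEnd α i → y ∈ U
    · obtain ⟨s, hs, h'⟩ := h
      exact ⟨s, hs, fun _ => h'⟩
    · exact ⟨1, one_pos, fun h' => (h h').elim⟩
  choose s hs₀ hs using hs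
  obtain ⟨ε, hε₀, hεδ, hε₁, hεs⟩ : ∃ ε > 0, ε ≤ δ ∧ (p : ℝ) + ε ≤ 1 ∧ ∀ i, ε ≤ s i := by
    have : Nonempty (Fin r) := ⟨⟨0, by omega⟩⟩
    obtain ⟨i, hi⟩ := Finite.exists_min s
    refine ⟨min δ (min (1 - p) (s i)), lt_min hδ (lt_min (by linarith [p.2.2]) (hs₀ i)),
      min_le_left _ _, ?_, fun j => (min_le_right _ _).trans ((min_le_right _ _).trans (hi j))⟩
    linarith [(min_le_right δ (min (1 - (p : ℝ)) (s i))).trans (min_le_left _ _)]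
  have key : ∀ n : ℕ, ((symExchange hpos hsum ^ n) p : ℝ) + ε ≤ 1 ∧
      (∀ y : Set.Ico (0 : ℝ) 1, ((symExchange hpos hsum ^ n) p : ℝ) < y →
        (y : ℝ) < (symExchange hpos hsum ^ n) p + ε → y ∈ U) ∧
      ∀ δ > 0, ∃ y : Set.Ico (0 : ℝ) 1, ((symExchange hpos hsum ^ n) p : ℝ) - δ < y ∧
        (y : ℝ) ≤ (symExchange hpos hsum ^ n) p ∧ y ∉ U := by
    intro n
    induction n with
    | zero => exact ⟨hε₁, fun y h₁ h₂ => hright y h₁ (h₂.trans_le (add_le_add_right hεδ _)), hleft⟩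
    | succ n ih =>
      obtain ⟨ih₁, ih₂, ih₃⟩ := ih
      have hcut : ∀ i : Fin r, 0 < (i : ℕ) →
          ((symExchange hpos hsum ^ n) p : ℝ) < leftEnd α i →
          ((symExchange hpos hsum ^ n) p : ℝ) + ε ≤ leftEnd α i := by
        intro i _ hlt
        by_contra! hlt'
        have hgerm := hs i ⟨leftEnd α i - (symExchange hpos hsum ^ n) p, by linarith,
          fun y h₁ h₂ => ih₂ y (by linarith) (by linarith)⟩
        have := hεs i
        obtain ⟨y, hy₁, hy₂, hyU⟩ := ih₃
          ((symExchange hpos hsum ^ n) p - (leftEnd α i - s i)) (by linarith)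
        exact hyU (hgerm y (by linarith) (by linarith))
      rw [pow_succ', Equiv.Perm.mul_apply]
      have h₁ := mem_right_of_symExchange hpos hsum hU ih₁ hcut ih₂
      exact ⟨h₁.1, h₁.2, exists_notMem_left_of_symExchange hpos hsum hU (hne n) ih₃⟩
  have hfar : ∀ m n : ℕ, ((symExchange hpos hsum ^ m) p : ℝ) < (symExchange hpos hsum ^ n) p →
      ((symExchange hpos hsum ^ m) p : ℝ) + ε ≤ (symExchange hpos hsum ^ n) p := by
    intro m n hlt
    by_contra! hlt'
    obtain ⟨y, hy₁, hy₂, hyU⟩ := (key n).2.2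
      ((symExchange hpos hsum ^ n) p - (symExchange hpos hsum ^ m) p) (by linarith)
    exact hyU ((key m).2.1 y (by linarith) (by linarith))
  have hinj : ∀ m n : ℕ, m < n → (symExchange hpos hsum ^ m) p ≠ (symExchange hpos hsum ^ n) p := by
    intro m n hmn heq
    obtain ⟨k, rfl⟩ := Nat.exists_eq_add_of_lt hmn
    rw [show m + k + 1 = m + (k + 1) by ring, pow_add, Equiv.Perm.mul_apply] at heq
    exact pow_apply_ne_self hpos hsum hindep hr p k.succ_pos
      ((symExchange hpos hsum ^ m).injective heq).symm
  -- Two of the infinitely many orbit points lie in the same interval `[a ε, (a + 1) ε)`.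
  have hmem : ∀ n : ℕ, ⌊((symExchange hpos hsum ^ n) p : ℝ) / ε⌋₊ ∈ Set.Iic ⌊1 / ε⌋₊ := fun n =>
    Nat.floor_le_floor (div_le_div_of_nonneg_right ((symExchange hpos hsum ^ n) p).2.2.le hε₀.le)
  obtain ⟨m, n, hmn, heq⟩ := Set.Finite.exists_lt_map_eq_of_forall_mem hmem (Set.finite_Iic _)
  have hclose : ∀ m n : ℕ, ⌊((symExchange hpos hsum ^ m) p : ℝ) / ε⌋₊
      = ⌊((symExchange hpos hsum ^ n) p : ℝ) / ε⌋₊ →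
      ((symExchange hpos hsum ^ n) p : ℝ) < (symExchange hpos hsum ^ m) p + ε := by
    intro m n heq
    have h₁ := Nat.floor_le (div_nonneg ((symExchange hpos hsum ^ m) p).2.1 hε₀.le)
    have h₂ := Nat.lt_floor_add_one (((symExchange hpos hsum ^ n) p : ℝ) / ε)
    rw [← heq] at h₂
    rw [le_div_iff₀ hε₀] at h₁
    rw [div_lt_iff₀ hε₀] at h₂
    linarith
  rcases lt_or_gt_of_ne fun h => hinj m n hmn (Subtype.ext h) with h | h
  · linarith [hfar m n h, hclose m n heq]
  · linarith [hfar n m h, hclose n m heq.symm]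

/-- An invariant set has no left boundary points: the two-sided orbit of such a point would lead
from a left end point to a left end point other than `0`. The backward half of the orbit is a forward
orbit of the symmetric exchange with reversed lengths. -/
theorem not_isLeftBoundary (hindep : LinearIndependent ℚ α) (hr : 2 ≤ r)
    {U : Set (Set.Ico (0 : ℝ) 1)} (hU : ∀ x, symExchange hpos hsum x ∈ U ↔ x ∈ U)
    (p : Set.Ico (0 : ℝ) 1) : ¬ IsLeftBoundary U p := by
  intro hp
  obtain ⟨m, i, hi, hm⟩ := hp.exists_pow_eq_leftEnd hpos hsum hindep hr hU
  have hpos' : ∀ k, 0 < α (Fin.rev k) := fun k => hpos _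
  have hsum' : ∑ k, α (Fin.rev k) = 1 := (Equiv.sum_comp Fin.revPerm α).trans hsum
  have hinv := symExchange_rev hpos hsum hpos' hsum'
  obtain ⟨n, j, -, hn⟩ := hp.exists_pow_eq_leftEnd hpos' hsum'
    (hindep.comp _ Fin.rev_injective) hr (fun x => by
      rw [hinv, ← hU, Equiv.Perm.coe_inv, Equiv.apply_symm_apply])
  rw [hinv, inv_pow] at hn
  have hj := leftEnd_rev_eq hsum (Fin.rev j)
  rw [Fin.rev_rev, ← symExchange_leftPoint hpos hsum] at hj
  rw [hj] at hn
  have hn' := Subtype.ext hn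
  rw [Equiv.Perm.inv_eq_iff_eq] at hn'
  rw [hn', ← Equiv.Perm.mul_apply, ← Equiv.Perm.mul_apply, ← pow_add, ← pow_succ] at hm
  exact pow_leftPoint_ne hpos hsum hindep _ i hi (Nat.succ_pos _) hm

/-! ### Minimality -/

/-- A nonempty invariant set that contains a right neighbourhood of each of its points is
everything. -/
theorem eq_univ_of_invariant (hindep : LinearIndependent ℚ α) (hr : 2 ≤ r)
    {U : Set (Set.Ico (0 : ℝ) 1)} (hU : ∀ x, symExchange hpos hsum x ∈ U ↔ x ∈ U)
    (hne : U.Nonempty) (hright : ∀ x ∈ U, ∃ δ > 0, ∀ y : Set.Ico (0 : ℝ) 1,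
      (x : ℝ) < y → (y : ℝ) < x + δ → y ∈ U) : U = Set.univ := by
  rw [Set.eq_univ_iff_forall]
  by_contra! hz
  by_cases hord : ∃ z ∉ U, ∃ y ∈ U, (z : ℝ) < y
  · -- The last point outside `U` before `y` would be a left boundary point.
    obtain ⟨z, hz, y, hy, hzy⟩ := hord
    set S : Set ℝ := {t | t ≤ y ∧ ∃ x : Set.Ico (0 : ℝ) 1, x ∉ U ∧ (x : ℝ) = t} with hS
    have hSne : S.Nonempty := ⟨z, hzy.le, z, hz, rfl⟩
    have hSb : BddAbove S := ⟨y, fun t ht => ht.1⟩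
    have h₁ : (z : ℝ) ≤ sSup S := le_csSup hSb ⟨hzy.le, z, hz, rfl⟩
    have h₂ : sSup S ≤ y := csSup_le hSne fun t ht => ht.1
    let p : Set.Ico (0 : ℝ) 1 := ⟨sSup S, z.2.1.trans h₁, h₂.trans_lt y.2.2⟩
    have hpS : (p : ℝ) = sSup S := rfl
    refine not_isLeftBoundary hpos hsum hindep hr hU p ⟨?_, fun δ hδ => ?_⟩
    · rcases h₂.eq_or_lt with h₂ | h₂
      · rw [show p = y from Subtype.ext h₂]
        exact hright y hy
      · refine ⟨y - p, by linarith, fun x hx₁ hx₂ => ?_⟩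
        by_contra hx
        have := le_csSup hSb (show (x : ℝ) ∈ S from ⟨by linarith, x, hx, rfl⟩)
        linarith
    · obtain ⟨t, ht, hlt⟩ := exists_lt_of_lt_csSup hSne (show sSup S - δ < sSup S by linarith)
      obtain ⟨-, x, hx, rfl⟩ := id ht
      exact ⟨x, hlt, le_csSup hSb ht, hx⟩
  · -- `U` would be an initial segment containing the left end `a` of the last interval; beyond
    -- `a` the exchange is the translation by `-a`, which moves a point outside `U` into `U`.
    push Not at hord
    obtain ⟨z, hz⟩ := hz
    obtain ⟨c, hc⟩ := hne
    set b : Fin r := ⟨r - 1, by omega⟩ with hb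
    have hlast : leftEnd α b + α b = 1 := by
      have := leftEnd_add_sum_Ioi (α := α) b
      rw [hsum, Finset.sum_eq_zero, add_zero] at this
      · exact this
      · intro i hi
        rw [Finset.mem_Ioi, Fin.lt_def] at hi
        have := i.2
        simp only [hb] at hi
        omega
    have hbpos : 0 < leftEnd α b := by
      have := leftEnd_add_le hpos (a := ⟨0, by omega⟩) (b := b) (by rw [Fin.lt_def, hb]; simp; omega)
      rw [leftEnd_of_val_eq_zero rfl] at this
      linarith [hpos ⟨0, by omega⟩]
    have h0 : symExchange hpos hsum (leftPoint hpos hsum b) ∈ U := by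
      by_contra h0
      have h₁ := hord _ h0 c hc
      have h₂ : (symExchange hpos hsum (leftPoint hpos hsum b) : ℝ) = 0 := by
        rw [symExchange_leftPoint, hlast, sub_self]
      rw [h₂] at h₁
      exact h0 ((Subtype.ext (h₂.trans (le_antisymm c.2.1 h₁)) :
        symExchange hpos hsum (leftPoint hpos hsum b) = c) ▸ hc)
    have hstep : ∀ z ∉ U, symExchange hpos hsum z ∉ U ∧
        (symExchange hpos hsum z : ℝ) = z - leftEnd α b := by
      intro z hz
      refine ⟨(hU z).not.mpr hz, ?_⟩
      have h₁ := hord z hz _ ((hU _).mp h0)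
      rw [coe_leftPoint] at h₁
      rw [symExchange_apply, letter_eq_of_mem hpos hsum h₁ (by linarith [z.2.2])]
      linarith
    have hiter : ∀ n : ℕ, (symExchange hpos hsum ^ n) z ∉ U ∧
        ((symExchange hpos hsum ^ n) z : ℝ) = z - n * leftEnd α b := by
      intro n
      induction n with
      | zero => simpa using hz
      | succ n ih =>
        rw [pow_succ', Equiv.Perm.mul_apply]
        refine ⟨(hstep _ ih.1).1, ?_⟩
        rw [(hstep _ ih.1).2, ih.2]
        push_cast
        ring
    obtain ⟨n, hn⟩ := exists_nat_gt (z / leftEnd α b)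
    rw [div_lt_iff₀ hbpos] at hn
    linarith [(hiter n).2, ((symExchange hpos hsum ^ n) z).2.1]

/-- Two-sided orbits are dense from the right. -/
theorem exists_zpow_mem_Ico (hindep : LinearIndependent ℚ α) (hr : 2 ≤ r) {c d : ℝ} (hc : 0 ≤ c)
    (hcd : c < d) (hd : d ≤ 1) (x : Set.Ico (0 : ℝ) 1) :
    ∃ k : ℤ, c ≤ (symExchange hpos hsum ^ k) x ∧ ((symExchange hpos hsum ^ k) x : ℝ) < d := by
  suffices h : {x | ∃ k : ℤ, c ≤ (symExchange hpos hsum ^ k) x ∧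
      ((symExchange hpos hsum ^ k) x : ℝ) < d} = Set.univ from
    (Set.eq_univ_iff_forall.mp h) x
  refine eq_univ_of_invariant hpos hsum hindep hr (fun x => ⟨?_, ?_⟩)
    ⟨⟨c, hc, by linarith⟩, 0, by simpa using hcd⟩ ?_
  · rintro ⟨k, hk⟩
    refine ⟨k + 1, ?_⟩
    rwa [zpow_add_one, Equiv.Perm.mul_apply]
  · rintro ⟨k, hk⟩
    refine ⟨k - 1, ?_⟩
    rwa [← Equiv.Perm.mul_apply, ← zpow_add_one, sub_add_cancel]
  · rintro x ⟨k, hk₁, hk₂⟩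
    obtain ⟨δ, hδ, h⟩ := exists_zpow_eq_add hpos hsum x k
    refine ⟨min δ (d - (symExchange hpos hsum ^ k) x), lt_min hδ (by linarith),
      fun y h₁ h₂ => ⟨k, ?_⟩⟩
    have h₃ := min_le_left δ (d - (symExchange hpos hsum ^ k) x)
    have h₄ := min_le_right δ (d - (symExchange hpos hsum ^ k) x)
    rw [h y h₁.le (by linarith)]
    constructor <;> linarith

/-! ### The reflection -/

/-- The reflection `x ↦ 1 - x` conjugates the exchange to its inverse: on interiors of intervals,
the exchange is the reflection of the interval followed by the reflection of `[0,1]`. -/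
theorem letter_eq_and_add_eq_one {x y : Set.Ico (0 : ℝ) 1}
    (hx : (x : ℝ) ≠ leftEnd α (letter α hpos hsum x))
    (h : (y : ℝ) + symExchange hpos hsum x = 1) :
    letter α hpos hsum y = letter α hpos hsum x ∧ (symExchange hpos hsum y : ℝ) + x = 1 := by
  have h₁ := (leftEnd_letter_le hpos hsum x).lt_of_ne' hx
  have h₂ := lt_leftEnd_letter_add hpos hsum x
  have h₃ := symExchange_apply hpos hsum x
  have h₄ : letter α hpos hsum y = letter α hpos hsum x :=
    letter_eq_of_mem hpos hsum (by linarith) (by linarith)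
  refine ⟨h₄, ?_⟩
  rw [symExchange_apply, h₄]
  linarith

theorem pow_add_eq_one_of_add_pow_eq_one {x : Set.Ico (0 : ℝ) 1} (n : ℕ)
    (hx : ∀ j < n, ((symExchange hpos hsum ^ j) x : ℝ)
      ≠ leftEnd α (letter α hpos hsum ((symExchange hpos hsum ^ j) x)))
    {y : Set.Ico (0 : ℝ) 1} (h : (y : ℝ) + (symExchange hpos hsum ^ n) x = 1) :
    ((symExchange hpos hsum ^ n) y : ℝ) + x = 1 := by
  induction n generalizing y with
  | zero => simpa using h
  | succ n ih =>
    rw [pow_succ', Equiv.Perm.mul_apply] at h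
    rw [pow_succ, Equiv.Perm.mul_apply]
    exact ih (fun j hj => hx j (hj.trans n.lt_succ_self))
      (letter_eq_and_add_eq_one hpos hsum (hx n n.lt_succ_self) h).2

/-- Points close to `x` on its right do not meet left end points during `n` steps. -/
theorem exists_pow_ne_leftEnd (x : Set.Ico (0 : ℝ) 1) (n : ℕ) :
    ∃ δ > 0, (x : ℝ) + δ ≤ 1 ∧ ∀ y : Set.Ico (0 : ℝ) 1, (x : ℝ) < y → (y : ℝ) < x + δ →
      ((symExchange hpos hsum ^ n) y : ℝ) - (symExchange hpos hsum ^ n) x = y - x ∧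
      ∀ j < n, ((symExchange hpos hsum ^ j) y : ℝ)
        ≠ leftEnd α (letter α hpos hsum ((symExchange hpos hsum ^ j) y)) := by
  obtain ⟨δ, hδ, hδ₁, h⟩ := exists_letter_pow_eq hpos hsum x n
  refine ⟨δ, hδ, hδ₁, fun y h₁ h₂ => ⟨pow_sub_pow_of_letter_eq hpos hsum (h y h₁.le h₂),
    fun j hj => ?_⟩⟩
  have h₃ := pow_sub_pow_of_letter_eq hpos hsum fun i hi => h y h₁.le h₂ i (hi.trans hj)
  have h₄ := leftEnd_letter_le hpos hsum ((symExchange hpos hsum ^ j) x)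
  rw [h y h₁.le h₂ j hj] at h₄
  intro h₅
  linarith

/-- On a left neighbourhood of `1 - q` the power `T ^ (-k)` is the reflection of `T ^ k` on a right
neighbourhood of `q`. -/
theorem exists_zpow_neg_add_zpow (q : Set.Ico (0 : ℝ) 1) (k : ℤ) :
    ∃ δ > 0, ∀ y : Set.Ico (0 : ℝ) 1, 1 - (q : ℝ) - δ < y → (y : ℝ) < 1 - q →
      ((symExchange hpos hsum ^ (-k)) y : ℝ) + (symExchange hpos hsum ^ k) q = y + q := by
  obtain ⟨n, rfl | rfl⟩ := k.eq_nat_or_neg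
  · obtain ⟨δ, hδ, hδ₁, h⟩ := exists_pow_ne_leftEnd hpos hsum q n
    refine ⟨δ, hδ, fun y h₁ h₂ => ?_⟩
    let x : Set.Ico (0 : ℝ) 1 := ⟨1 - y, by linarith [y.2.2], by linarith [q.2.1]⟩
    have hx : (x : ℝ) = 1 - y := rfl
    obtain ⟨h₃, h₄⟩ := h x (by linarith) (by linarith)
    let z : Set.Ico (0 : ℝ) 1 := ⟨1 - (symExchange hpos hsum ^ n) x,
      by linarith [((symExchange hpos hsum ^ n) x).2.2],
      by linarith [((symExchange hpos hsum ^ n) q).2.1]⟩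
    have hz : (z : ℝ) = 1 - (symExchange hpos hsum ^ n) x := rfl
    have h₅ := pow_add_eq_one_of_add_pow_eq_one hpos hsum n h₄ (y := z) (by linarith)
    have h₆ : (symExchange hpos hsum ^ n) z = y := Subtype.ext (by linarith)
    rw [zpow_neg, zpow_natCast, ← h₆, Equiv.Perm.coe_inv, Equiv.symm_apply_apply, h₆]
    linarith
  · set q' := (symExchange hpos hsum ^ (-(n : ℤ))) q with hq'
    have hqq' : (symExchange hpos hsum ^ n) q' = q := by
      rw [hq', zpow_neg, zpow_natCast, Equiv.Perm.coe_inv, Equiv.apply_symm_apply]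
    obtain ⟨δ, hδ, hδ₁, h⟩ := exists_pow_ne_leftEnd hpos hsum q' n
    refine ⟨δ, hδ, fun y h₁ h₂ => ?_⟩
    let x : Set.Ico (0 : ℝ) 1 := ⟨q' + (1 - q - y), by linarith [q'.2.1], by linarith⟩
    have hx : (x : ℝ) = q' + (1 - q - y) := rfl
    obtain ⟨h₃, h₄⟩ := h x (by linarith) (by linarith)
    rw [hqq'] at h₃
    have h₅ := pow_add_eq_one_of_add_pow_eq_one hpos hsum n h₄ (y := y) (by linarith)
    rw [neg_neg, zpow_natCast]
    linarith

/-- The times between visits of an interval `[c, d)` are bounded. Near a point of `[0,1]` the right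
and the left neighbours each reach `[c, d)` at a common time, the left ones by reflection, and
`[0,1]` is compact. -/
theorem exists_zpow_mem_Ico_bounded (hindep : LinearIndependent ℚ α) (hr : 2 ≤ r) {c d : ℝ}
    (hc : 0 ≤ c) (hcd : c < d) (hd : d ≤ 1) :
    ∃ K : ℕ, ∀ x : Set.Ico (0 : ℝ) 1, ∃ k : ℤ, |k| ≤ K ∧
      c ≤ (symExchange hpos hsum ^ k) x ∧ ((symExchange hpos hsum ^ k) x : ℝ) < d := by
  suffices h : ∃ K : ℕ, ∀ x : Set.Ico (0 : ℝ) 1, (x : ℝ) ∈ Set.Icc (0 : ℝ) 1 → ∃ k : ℤ, |k| ≤ K ∧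
      c ≤ (symExchange hpos hsum ^ k) x ∧ ((symExchange hpos hsum ^ k) x : ℝ) < d by
    obtain ⟨K, hK⟩ := h
    exact ⟨K, fun x => hK x ⟨x.2.1, x.2.2.le⟩⟩
  refine isCompact_Icc.induction_on (p := fun s : Set ℝ => ∃ K : ℕ, ∀ x : Set.Ico (0 : ℝ) 1,
    (x : ℝ) ∈ s → ∃ k : ℤ, |k| ≤ K ∧ c ≤ (symExchange hpos hsum ^ k) x ∧
      ((symExchange hpos hsum ^ k) x : ℝ) < d) ⟨0, by simp⟩ ?_ ?_ ?_
  · rintro s t hst ⟨K, hK⟩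
    exact ⟨K, fun x hx => hK x (hst hx)⟩
  · rintro s t ⟨K, hK⟩ ⟨L, hL⟩
    refine ⟨max K L, fun x hx => ?_⟩
    rcases hx with hx | hx
    · obtain ⟨k, hk, h⟩ := hK x hx
      exact ⟨k, hk.trans (by exact_mod_cast le_max_left K L), h⟩
    · obtain ⟨k, hk, h⟩ := hL x hx
      exact ⟨k, hk.trans (by exact_mod_cast le_max_right K L), h⟩
  · intro p hp
    have hright : ∃ δ > 0, ∃ k : ℤ, ∀ x : Set.Ico (0 : ℝ) 1, p ≤ x → (x : ℝ) < p + δ →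
        c ≤ (symExchange hpos hsum ^ k) x ∧ ((symExchange hpos hsum ^ k) x : ℝ) < d := by
      rcases hp.2.eq_or_lt with rfl | hp1
      · exact ⟨1, one_pos, 0, fun x h₁ _ => absurd x.2.2 h₁.not_gt⟩
      · obtain ⟨k, hk₁, hk₂⟩ := exists_zpow_mem_Ico hpos hsum hindep hr hc hcd hd ⟨p, hp.1, hp1⟩
        obtain ⟨δ, hδ, h⟩ := exists_zpow_eq_add hpos hsum ⟨p, hp.1, hp1⟩ k
        refine ⟨min δ (d - (symExchange hpos hsum ^ k) ⟨p, hp.1, hp1⟩),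
          lt_min hδ (by linarith), k, fun y h₁ h₂ => ?_⟩
        have h₃ := min_le_left δ (d - (symExchange hpos hsum ^ k) ⟨p, hp.1, hp1⟩)
        have h₄ := min_le_right δ (d - (symExchange hpos hsum ^ k) ⟨p, hp.1, hp1⟩)
        rw [h y h₁ (by simp only; linarith)]
        constructor <;> simp only <;> linarith
    have hleft : ∃ δ > 0, ∃ k : ℤ, ∀ x : Set.Ico (0 : ℝ) 1, p - δ < x → (x : ℝ) < p →
        c ≤ (symExchange hpos hsum ^ k) x ∧ ((symExchange hpos hsum ^ k) x : ℝ) < d := by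
      rcases hp.1.eq_or_lt with rfl | hp0
      · exact ⟨1, one_pos, 0, fun x _ h₂ => absurd x.2.1 h₂.not_ge⟩
      · let q : Set.Ico (0 : ℝ) 1 := ⟨1 - p, by linarith [hp.2], by linarith⟩
        have hq : (q : ℝ) = 1 - p := rfl
        obtain ⟨k, hk₁, hk₂⟩ := exists_zpow_mem_Ico hpos hsum hindep hr (c := 1 - d) (d := 1 - c)
          (by linarith) (by linarith) (by linarith) q
        obtain ⟨δ, hδ, h⟩ := exists_zpow_neg_add_zpow hpos hsum q k
        refine ⟨min δ (1 - c - (symExchange hpos hsum ^ k) q), lt_min hδ (by linarith), -k,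
          fun y h₁ h₂ => ?_⟩
        have h₃ := min_le_left δ (1 - c - (symExchange hpos hsum ^ k) q)
        have h₄ := min_le_right δ (1 - c - (symExchange hpos hsum ^ k) q)
        have h₅ := h y (by linarith) (by linarith)
        constructor <;> linarith
    obtain ⟨δ₁, hδ₁, k₁, h₁⟩ := hright
    obtain ⟨δ₂, hδ₂, k₂, h₂⟩ := hleft
    refine ⟨Set.Ioo (p - δ₂) (p + δ₁), mem_nhdsWithin_of_mem_nhds
      (Ioo_mem_nhds (by linarith) (by linarith)), (max |k₁| |k₂|).toNat, fun x hx => ?_⟩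
    rw [Int.toNat_of_nonneg ((abs_nonneg k₁).trans (le_max_left _ _))]
    rcases le_or_gt p x with hpx | hpx
    · exact ⟨k₁, le_max_left _ _, h₁ x hpx hx.2⟩
    · exact ⟨k₂, le_max_right _ _, h₂ x hx.1 hpx⟩

/-- Forward orbits are dense from the right. -/
theorem exists_pow_mem_Ico (hindep : LinearIndependent ℚ α) (hr : 2 ≤ r) {c d : ℝ}
    (hc : 0 ≤ c) (hcd : c < d) (hd : d ≤ 1) (x : Set.Ico (0 : ℝ) 1) :
    ∃ n : ℕ, c ≤ (symExchange hpos hsum ^ n) x ∧ ((symExchange hpos hsum ^ n) x : ℝ) < d := by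
  obtain ⟨K, hK⟩ := exists_zpow_mem_Ico_bounded hpos hsum hindep hr hc hcd hd
  obtain ⟨k, hk, h⟩ := hK ((symExchange hpos hsum ^ K) x)
  refine ⟨(k + K).toNat, ?_⟩
  rw [← Equiv.Perm.mul_apply, ← zpow_natCast, ← zpow_add] at h
  rwa [← zpow_natCast, Int.toNat_of_nonneg (by linarith [(abs_le.mp hk).1])]

/-! ### The language of the exchange -/

/-- The word of length `n` coding the first `n` steps of the orbit of `x`. -/
noncomputable def itinerary (n : ℕ) (x : Set.Ico (0 : ℝ) 1) (j : Fin n) : Fin r :=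
  letter α hpos hsum ((symExchange hpos hsum ^ (j : ℕ)) x)

theorem itinerary_eq_iff {n : ℕ} {x y : Set.Ico (0 : ℝ) 1} :
    itinerary hpos hsum n x = itinerary hpos hsum n y ↔
      ∀ j < n, letter α hpos hsum ((symExchange hpos hsum ^ j) x)
        = letter α hpos hsum ((symExchange hpos hsum ^ j) y) :=
  ⟨fun h j hj => congrFun h ⟨j, hj⟩, fun h => funext fun j => h j j.2⟩

/-- By minimality the forward orbit of any point realizes the coding of any other point. -/
theorem exists_itinerary_pow_eq (hindep : LinearIndependent ℚ α) (n : ℕ)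
    (x₀ x : Set.Ico (0 : ℝ) 1) :
    ∃ i : ℕ, itinerary hpos hsum n ((symExchange hpos hsum ^ i) x₀)
      = itinerary hpos hsum n x := by
  rcases lt_or_ge r 2 with hr | hr
  · have : Subsingleton (Fin r) := Fin.subsingleton_iff_le_one.mpr (by omega)
    exact ⟨0, Subsingleton.elim _ _⟩
  · obtain ⟨δ, hδ, hle, h⟩ := exists_letter_pow_eq hpos hsum x n
    obtain ⟨i, h₁, h₂⟩ := exists_pow_mem_Ico hpos hsum hindep hr x.2.1 (lt_add_of_pos_right _ hδ)
      hle x₀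
    exact ⟨i, ((itinerary_eq_iff hpos hsum).mpr (h _ h₁ h₂)).symm⟩

theorem factors_codingWord (hindep : LinearIndependent ℚ α) (x₀ : Set.Ico (0 : ℝ) 1) (n : ℕ) :
    InfiniteWord.factors (codingWord α hpos hsum Fin.revPerm x₀) n
      = Set.range (itinerary hpos hsum n) := by
  ext w
  constructor
  · rintro ⟨i, hi⟩
    refine ⟨(symExchange hpos hsum ^ i) x₀, funext fun j => ?_⟩
    rw [hi j, codingWord, itinerary, add_comm, zpow_add, Equiv.Perm.mul_apply, zpow_natCast]
  · rintro ⟨x, rfl⟩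
    obtain ⟨i, hi⟩ := exists_itinerary_pow_eq hpos hsum hindep n x₀ x
    refine ⟨i, fun j => ?_⟩
    rw [← hi, codingWord, itinerary, add_comm, zpow_add, Equiv.Perm.mul_apply, zpow_natCast,
      zpow_natCast]

theorem factors_codingWord_nat (hindep : LinearIndependent ℚ α) (x₀ : Set.Ico (0 : ℝ) 1) (n : ℕ) :
    InfiniteWord.factors (fun m : ℕ => codingWord α hpos hsum Fin.revPerm x₀ m) n
      = Set.range (itinerary hpos hsum n) := by
  ext w
  constructor
  · rintro ⟨i, hi⟩
    refine ⟨(symExchange hpos hsum ^ i) x₀, funext fun j => ?_⟩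
    rw [hi j]
    simp only [codingWord, itinerary, zpow_natCast, Nat.cast_id]
    rw [add_comm, pow_add, Equiv.Perm.mul_apply]
  · rintro ⟨x, rfl⟩
    obtain ⟨i, hi⟩ := exists_itinerary_pow_eq hpos hsum hindep n x₀ x
    refine ⟨i, fun j => ?_⟩
    rw [← hi]
    simp only [codingWord, itinerary, zpow_natCast, Nat.cast_id]
    rw [add_comm, pow_add, Equiv.Perm.mul_apply]

/-! ### Factor complexity -/

/-- The points that reach a left end point other than `0` in fewer than `n` steps: the points other
than `0` that separate consecutive sets of constant coding of length `n`. -/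
noncomputable def cutPoint (n : ℕ) (a : Fin n × {i : Fin r // 0 < (i : ℕ)}) : Set.Ico (0 : ℝ) 1 :=
  ((symExchange hpos hsum) ^ (a.1 : ℕ))⁻¹ (leftPoint hpos hsum a.2)

theorem cutPoint_injective (hindep : LinearIndependent ℚ α) (n : ℕ) :
    Function.Injective (cutPoint hpos hsum n) := by
  have key : ∀ a b : Fin n × {i : Fin r // 0 < (i : ℕ)}, (a.1 : ℕ) < b.1 →
      cutPoint hpos hsum n a ≠ cutPoint hpos hsum n b := by
    intro a b hab h
    obtain ⟨k, hk⟩ := Nat.exists_eq_add_of_lt hab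
    have h₁ : (symExchange hpos hsum ^ (k + 1)) (leftPoint hpos hsum a.2)
        = leftPoint hpos hsum b.2 := by
      rw [cutPoint, cutPoint, Equiv.Perm.eq_inv_iff_eq, hk,
        show (a.1 : ℕ) + k + 1 = (k + 1) + a.1 by ring, pow_add, Equiv.Perm.mul_apply,
        Equiv.Perm.coe_inv, Equiv.apply_symm_apply] at h
      exact h
    exact pow_leftPoint_ne hpos hsum hindep _ _ b.2.2 k.succ_pos (congrArg Subtype.val h₁)
  intro a b h
  rcases lt_trichotomy (a.1 : ℕ) b.1 with hab | hab | hab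
  · exact (key a b hab h).elim
  · rw [cutPoint, cutPoint, hab] at h
    have h₁ := congrArg (letter α hpos hsum) (Equiv.injective _ h)
    rw [letter_leftPoint, letter_leftPoint] at h₁
    exact Prod.ext (Fin.ext hab) (Subtype.ext h₁)
  · exact (key b a hab h.symm).elim

/-- The leftmost point of each set of constant coding of length `n`: `0` and the cut points. -/
def leftmostPoints (n : ℕ) : Set (Set.Ico (0 : ℝ) 1) :=
  insert ⟨0, le_rfl, one_pos⟩ (Set.range (cutPoint hpos hsum n))

theorem mem_leftmostPoints {n : ℕ} {x : Set.Ico (0 : ℝ) 1} :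
    x ∈ leftmostPoints hpos hsum n ↔ (x : ℝ) = 0 ∨ ∃ j < n, ∃ i : Fin r, 0 < (i : ℕ) ∧
      ((symExchange hpos hsum ^ j) x : ℝ) = leftEnd α i := by
  rw [leftmostPoints, Set.mem_insert_iff, Subtype.ext_iff]
  refine or_congr Iff.rfl ⟨?_, ?_⟩
  · rintro ⟨a, rfl⟩
    refine ⟨a.1, a.1.2, a.2, a.2.2, ?_⟩
    rw [cutPoint, Equiv.Perm.coe_inv, Equiv.apply_symm_apply, coe_leftPoint]
  · rintro ⟨j, hj, i, hi, h⟩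
    refine ⟨(⟨j, hj⟩, ⟨i, hi⟩), ?_⟩
    rw [cutPoint, Equiv.Perm.inv_eq_iff_eq]
    exact Subtype.ext h.symm

theorem finite_leftmostPoints (n : ℕ) : (leftmostPoints hpos hsum n).Finite :=
  (Set.finite_range _).insert _

theorem ncard_leftmostPoints (hindep : LinearIndependent ℚ α) (n : ℕ) :
    (leftmostPoints hpos hsum n).ncard = n * (r - 1) + 1 := by
  have hr : 0 < r := by
    rcases Nat.eq_zero_or_pos r with rfl | h
    · simp at hsum
    · exact h
  rw [leftmostPoints, Set.ncard_insert_of_notMem, ← Nat.card_coe_set_eq,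
    Nat.card_range_of_injective (cutPoint_injective hpos hsum hindep n), Nat.card_prod,
    Nat.card_fin, Nat.card_eq_fintype_card, Fintype.card_subtype]
  · have h : (Finset.univ.filter fun i : Fin r => 0 < (i : ℕ)) = Finset.univ.erase ⟨0, hr⟩ := by
      ext i
      simp [Fin.ext_iff, Nat.pos_iff_ne_zero]
    rw [h, Finset.card_erase_of_mem (Finset.mem_univ _), Finset.card_univ, Fintype.card_fin]
  · rintro ⟨a, ha⟩
    rw [cutPoint, Equiv.Perm.inv_eq_iff_eq] at ha
    have h₀ : (⟨0, le_rfl, one_pos⟩ : Set.Ico (0 : ℝ) 1) = leftPoint hpos hsum ⟨0, hr⟩ :=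
      Subtype.ext (leftEnd_of_val_eq_zero rfl).symm
    rw [h₀] at ha
    rcases Nat.eq_zero_or_pos (a.1 : ℕ) with h | h
    · rw [h, pow_zero, Equiv.Perm.one_apply] at ha
      have h₁ := congrArg (letter α hpos hsum) ha
      rw [letter_leftPoint, letter_leftPoint] at h₁
      have := a.2.2
      rw [h₁] at this
      simp at this
    · exact pow_leftPoint_ne hpos hsum hindep _ _ a.2.2 h (congrArg Subtype.val ha.symm)

theorem itinerary_injOn_leftmostPoints (n : ℕ) :
    Set.InjOn (itinerary hpos hsum n) (leftmostPoints hpos hsum n) := by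
  have key : ∀ x y : Set.Ico (0 : ℝ) 1, y ∈ leftmostPoints hpos hsum n →
      itinerary hpos hsum n x = itinerary hpos hsum n y → ¬ (x : ℝ) < y := by
    intro x y hy h hxy
    rw [itinerary_eq_iff] at h
    rcases (mem_leftmostPoints hpos hsum).mp hy with hy | ⟨j, hj, i, -, hy⟩
    · linarith [x.2.1]
    · have h₁ := pow_sub_pow_of_letter_eq hpos hsum fun k hk => h k (hk.trans hj)
      have h₂ := leftEnd_letter_le hpos hsum ((symExchange hpos hsum ^ j) x)
      have h₃ : letter α hpos hsum ((symExchange hpos hsum ^ j) y) = i :=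
        letter_eq_of_mem hpos hsum hy.ge (by linarith [hpos i])
      rw [h j hj, h₃] at h₂
      linarith
  intro x hx y hy h
  exact Subtype.ext (le_antisymm (not_lt.mp (key y x hx h.symm)) (not_lt.mp (key x y hy h)))

/-- The itinerary of `x` is that of the last leftmost point up to `x`. -/
theorem image_itinerary_leftmostPoints (n : ℕ) :
    itinerary hpos hsum n '' leftmostPoints hpos hsum n = Set.range (itinerary hpos hsum n) := by
  refine (Set.image_subset_range _ _).antisymm ?_
  rintro _ ⟨x, rfl⟩
  obtain ⟨p, ⟨hp, hpx⟩, hmax⟩ := Set.exists_max_image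
    {y ∈ leftmostPoints hpos hsum n | (y : ℝ) ≤ x} (fun y => (y : ℝ))
    ((finite_leftmostPoints hpos hsum n).subset (Set.sep_subset _ _))
    ⟨_, Set.mem_insert _ _, x.2.1⟩
  refine ⟨p, hp, (itinerary_eq_iff hpos hsum).mpr fun j => ?_⟩
  induction j using Nat.strong_induction_on with
  | _ j ih =>
    intro hj
    by_contra hne
    have hlt : ∀ i < j, letter α hpos hsum ((symExchange hpos hsum ^ i) p)
        = letter α hpos hsum ((symExchange hpos hsum ^ i) x) := fun i hi => ih i hi (hi.trans hj)
    have h₁ := pow_sub_pow_of_letter_eq hpos hsum hlt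
    obtain ⟨i, hi, h₂, h₃⟩ := exists_leftEnd_of_letter_ne hpos hsum (by linarith) hne
    -- Pulling back the separating end point gives a leftmost point in `(p, x]`.
    let z : Set.Ico (0 : ℝ) 1 := ⟨p + (leftEnd α i - (symExchange hpos hsum ^ j) p),
      by linarith [p.2.1], by linarith [x.2.2]⟩
    have hz : (z : ℝ) = p + (leftEnd α i - (symExchange hpos hsum ^ j) p) := rfl
    have h₄ := pow_sub_pow_of_letter_eq hpos hsum
      (letter_pow_eq_of_mem_Icc hpos hsum hlt (z := z) (by linarith) (by linarith))
    have := hmax z ⟨(mem_leftmostPoints hpos hsum).mpr (Or.inr ⟨j, hj, i, hi, by linarith⟩),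
      by linarith⟩
    linarith

theorem ncard_range_itinerary (hindep : LinearIndependent ℚ α) (n : ℕ) :
    (Set.range (itinerary hpos hsum n)).ncard = n * (r - 1) + 1 := by
  rw [← image_itinerary_leftmostPoints,
    (itinerary_injOn_leftmostPoints hpos hsum n).ncard_image, ncard_leftmostPoints hpos hsum hindep]

/-! ### Palindromes -/

/-- A point whose two-sided orbit avoids all left end points, including `0`. -/
def IsGeneric (x : Set.Ico (0 : ℝ) 1) : Prop :=
  ∀ (k : ℤ) (i : Fin r), ((symExchange hpos hsum ^ k) x : ℝ) ≠ leftEnd α i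

variable {hpos hsum} in
theorem IsGeneric.zpow {x : Set.Ico (0 : ℝ) 1} (hx : IsGeneric hpos hsum x) (m : ℤ) :
    IsGeneric hpos hsum ((symExchange hpos hsum ^ m) x) := by
  intro k i
  rw [← Equiv.Perm.mul_apply, ← zpow_add]
  exact hx _ i

variable {hpos hsum} in
theorem IsGeneric.pow_ne {x : Set.Ico (0 : ℝ) 1} (hx : IsGeneric hpos hsum x) (m : ℕ)
    (i : Fin r) : ((symExchange hpos hsum ^ m) x : ℝ) ≠ leftEnd α i := by
  rw [← zpow_natCast]
  exact hx m i

/-- A point `c` with `2 c` an integral combination of the lengths, not all coefficients even, is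
generic. -/
theorem isGeneric_of_two_mul_eq (hindep : LinearIndependent ℚ α) {x : Set.Ico (0 : ℝ) 1}
    {c : Fin r → ℤ} (hc : 2 * (x : ℝ) = ∑ l, (c l : ℝ) * α l) {l : Fin r} (hl : Odd (c l)) :
    IsGeneric hpos hsum x := by
  intro k i h
  obtain ⟨d, hd⟩ := exists_zpow_apply_sub hpos hsum x k
  rw [h, leftEnd_eq_sum_ite] at hd
  have h₁ := eq_of_sum_intCast_mul_eq hindep (c := c)
    (d := fun l => 2 * ((if l < i then 1 else 0) - d l)) (by
      rw [← hc]
      simp only [Int.cast_mul, Int.cast_sub, mul_assoc, sub_mul, ← Finset.mul_sum,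
        Finset.sum_sub_distrib]
      push_cast at hd ⊢
      linarith) l
  rw [h₁] at hl
  exact (Int.not_odd_iff_even.mpr (even_two_mul _)) hl

/-- Every right neighbourhood contains generic points, as only countably many points are not. -/
theorem exists_isGeneric (x : Set.Ico (0 : ℝ) 1) {δ : ℝ} (hδ : 0 < δ) :
    ∃ y : Set.Ico (0 : ℝ) 1, (x : ℝ) ≤ y ∧ (y : ℝ) < x + δ ∧ IsGeneric hpos hsum y := by
  have hcount : (Set.range fun a : ℤ × Fin r =>
      (((symExchange hpos hsum ^ a.1) (leftPoint hpos hsum a.2) : Set.Ico (0 : ℝ) 1) : ℝ)).Countable :=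
    Set.countable_range _
  obtain ⟨y, hy, h₁, h₂⟩ := (hcount.dense_compl ℝ).exists_between
    (show (x : ℝ) < min 1 (x + δ) from lt_min x.2.2 (by linarith))
  refine ⟨⟨y, x.2.1.trans h₁.le, h₂.trans_le (min_le_left _ _)⟩, h₁.le,
    h₂.trans_le (min_le_right _ _), fun k i h => hy ⟨(-k, i), ?_⟩⟩
  have h' : (symExchange hpos hsum ^ k) ⟨y, x.2.1.trans h₁.le, h₂.trans_le (min_le_left _ _)⟩
      = leftPoint hpos hsum i := Subtype.ext h
  simp only
  rw [← h', zpow_neg, Equiv.Perm.coe_inv, Equiv.symm_apply_apply]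

theorem pow_add_pow_eq_one {x y : Set.Ico (0 : ℝ) 1} (hx : IsGeneric hpos hsum x) {n : ℕ}
    (h : (y : ℝ) + (symExchange hpos hsum ^ n) x = 1) {j : ℕ} (hj : j ≤ n) :
    ((symExchange hpos hsum ^ j) y : ℝ) + (symExchange hpos hsum ^ (n - j)) x = 1 := by
  refine pow_add_eq_one_of_add_pow_eq_one hpos hsum j (fun i _ => ?_) ?_
  · rw [← Equiv.Perm.mul_apply, ← pow_add]
    exact hx.pow_ne _ _
  · rwa [← Equiv.Perm.mul_apply, ← pow_add, Nat.add_sub_cancel' hj]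

/-- If `y` is the reflection of `T ^ n x`, its coding of length `n` is the mirror image of that
of `x`. -/
theorem itinerary_eq_itinerary_rev {x y : Set.Ico (0 : ℝ) 1} (hx : IsGeneric hpos hsum x) {n : ℕ}
    (h : (y : ℝ) + (symExchange hpos hsum ^ n) x = 1) (j : Fin n) :
    itinerary hpos hsum n y j = itinerary hpos hsum n x j.rev := by
  have hj := j.2
  have h₁ := pow_add_pow_eq_one hpos hsum hx h hj.le
  rw [show n - (j : ℕ) = n - (j + 1) + 1 by omega, pow_succ', Equiv.Perm.mul_apply] at h₁
  rw [itinerary, itinerary, Fin.val_rev]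
  exact (letter_eq_and_add_eq_one hpos hsum (hx.pow_ne _ _) h₁).1

/-- Every palindromic itinerary is realized by a point `p` for which `T ^ j p` is the midpoint
of `T ^ j x` and of the reflection of `T ^ (n - j) x`, for all `j ≤ n`. Indeed, if `x` is generic
with a palindromic itinerary, then the reflection `y` of `T ^ n x` has the same itinerary, by
convexity so does the midpoint `p` of `x` and `y`, and the first `n` powers of the exchange
translate `x`, `y` and `p` together. -/
theorem exists_midpoint_of_palindrome {n : ℕ} {w : Fin n → Fin r}
    (hw : w ∈ Set.range (itinerary hpos hsum n)) (hpal : ∀ j : Fin n, w j = w j.rev) :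
    ∃ p x : Set.Ico (0 : ℝ) 1, itinerary hpos hsum n p = w ∧ itinerary hpos hsum n x = w ∧
      ∀ j ≤ n, 2 * ((symExchange hpos hsum ^ j) p : ℝ)
        = (symExchange hpos hsum ^ j) x + 1 - (symExchange hpos hsum ^ (n - j)) x := by
  obtain ⟨x₁, hx₁⟩ := hw
  obtain ⟨δ, hδ, -, h⟩ := exists_letter_pow_eq hpos hsum x₁ n
  obtain ⟨x, h₁, h₂, hx⟩ := exists_isGeneric hpos hsum x₁ hδ
  have hxw : itinerary hpos hsum n x = w :=
    ((itinerary_eq_iff hpos hsum).mpr (h x h₁ h₂)).symm.trans hx₁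
  have hr : 0 < r := Nat.pos_of_ne_zero fun h => by subst h; simp at hsum
  have hpos₁ : (0 : ℝ) < (symExchange hpos hsum ^ n) x :=
    ((symExchange hpos hsum ^ n) x).2.1.lt_of_ne' (by
      have := hx.pow_ne n ⟨0, hr⟩
      rwa [leftEnd_of_val_eq_zero rfl] at this)
  let y : Set.Ico (0 : ℝ) 1 := ⟨1 - (symExchange hpos hsum ^ n) x,
    by linarith [((symExchange hpos hsum ^ n) x).2.2], by linarith⟩
  have hy : (y : ℝ) + (symExchange hpos hsum ^ n) x = 1 := sub_add_cancel _ _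
  have hyw : itinerary hpos hsum n y = w := funext fun j => by
    rw [itinerary_eq_itinerary_rev hpos hsum hx hy, hxw, ← hpal]
  let p : Set.Ico (0 : ℝ) 1 := ⟨(x + y) / 2, by linarith [x.2.1, y.2.1],
    by linarith [x.2.2, y.2.2]⟩
  have hp : (p : ℝ) = (x + y) / 2 := rfl
  have hxp : ∀ j < n, letter α hpos hsum ((symExchange hpos hsum ^ j) x)
      = letter α hpos hsum ((symExchange hpos hsum ^ j) p) := by
    rcases le_total (x : ℝ) y with hxy | hxy
    · exact letter_pow_eq_of_mem_Icc hpos hsum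
        ((itinerary_eq_iff hpos hsum).mp (hxw.trans hyw.symm)) (by linarith) (by linarith)
    · have hyx := (itinerary_eq_iff hpos hsum).mp (hyw.trans hxw.symm)
      have h₃ := letter_pow_eq_of_mem_Icc hpos hsum hyx (z := p) (by linarith) (by linarith)
      exact fun j hj => (hyx j hj).symm.trans (h₃ j hj)
  refine ⟨p, x, ((itinerary_eq_iff hpos hsum).mpr hxp).symm.trans hxw, hxw, fun j hj => ?_⟩
  have h₃ := pow_sub_pow_of_letter_eq hpos hsum fun i hi => hxp i (hi.trans_le hj)
  have h₄ := pow_sub_pow_of_letter_eq hpos hsum fun i hi =>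
    (itinerary_eq_iff hpos hsum).mp (hxw.trans hyw.symm) i (hi.trans_le hj)
  have h₅ := pow_add_pow_eq_one hpos hsum hx hy hj
  linarith

/-- The midpoint of `[0,1)`. -/
noncomputable def center : Set.Ico (0 : ℝ) 1 := ⟨1 / 2, by norm_num⟩

theorem isGeneric_center (hindep : LinearIndependent ℚ α) : IsGeneric hpos hsum center := by
  have hr : 0 < r := Nat.pos_of_ne_zero fun h => by subst h; simp at hsum
  exact isGeneric_of_two_mul_eq hpos hsum hindep (c := fun _ => 1)
    (by simp [center, hsum]) (l := ⟨0, hr⟩) odd_one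

/-- The midpoint of the interval `I_k`. -/
noncomputable def pieceCenter (k : Fin r) : Set.Ico (0 : ℝ) 1 :=
  ⟨leftEnd α k + α k / 2, piece_subset hpos hsum k
    ((mem_piece_iff _ _ _).mpr ⟨by linarith [hpos k], by linarith [hpos k]⟩)⟩

theorem letter_pieceCenter (k : Fin r) : letter α hpos hsum (pieceCenter hpos hsum k) = k :=
  letter_eq_of_mem hpos hsum (by simp only [pieceCenter]; linarith [hpos k])
    (by simp only [pieceCenter]; linarith [hpos k])

theorem isGeneric_pieceCenter (hindep : LinearIndependent ℚ α) (k : Fin r) :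
    IsGeneric hpos hsum (pieceCenter hpos hsum k) := by
  refine isGeneric_of_two_mul_eq hpos hsum hindep
    (c := fun l => 2 * (if l < k then 1 else 0) + if l = k then 1 else 0) ?_ (l := k) (by simp)
  have h := leftEnd_eq_sum_ite (α := α) k
  simp only [pieceCenter, Int.cast_add, add_mul, Int.cast_mul, mul_assoc, Finset.sum_add_distrib,
    ← Finset.mul_sum]
  rw [← h]
  simp
  ring

theorem itinerary_inv_center_rev (hindep : LinearIndependent ℚ α) (m : ℕ) (j : Fin (2 * m)) :
    itinerary hpos hsum (2 * m) ((symExchange hpos hsum ^ (-(m : ℤ))) center) j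
      = itinerary hpos hsum (2 * m) ((symExchange hpos hsum ^ (-(m : ℤ))) center) j.rev := by
  have hc := (isGeneric_center hpos hsum hindep).zpow (-(m : ℤ))
  have hm : (symExchange hpos hsum ^ m) ((symExchange hpos hsum ^ (-(m : ℤ))) center) = center := by
    rw [zpow_neg, zpow_natCast, Equiv.Perm.coe_inv, Equiv.apply_symm_apply]
  have h₁ := pow_add_pow_eq_one hpos hsum hc (n := m) (y := center)
    (by rw [hm]; norm_num [center]) (le_refl m)
  refine itinerary_eq_itinerary_rev hpos hsum hc ?_ j
  rw [Nat.sub_self, pow_zero, Equiv.Perm.one_apply] at h₁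
  rw [two_mul, pow_add, Equiv.Perm.mul_apply, hm]
  linarith

theorem itinerary_inv_pieceCenter_rev (hindep : LinearIndependent ℚ α) (k : Fin r) (m : ℕ)
    (j : Fin (2 * m + 1)) :
    itinerary hpos hsum (2 * m + 1)
        ((symExchange hpos hsum ^ (-(m : ℤ))) (pieceCenter hpos hsum k)) j
      = itinerary hpos hsum (2 * m + 1)
        ((symExchange hpos hsum ^ (-(m : ℤ))) (pieceCenter hpos hsum k)) j.rev := by
  have hc := (isGeneric_pieceCenter hpos hsum hindep k).zpow (-(m : ℤ))
  have hm : (symExchange hpos hsum ^ m) ((symExchange hpos hsum ^ (-(m : ℤ)))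
      (pieceCenter hpos hsum k)) = pieceCenter hpos hsum k := by
    rw [zpow_neg, zpow_natCast, Equiv.Perm.coe_inv, Equiv.apply_symm_apply]
  have hT : (symExchange hpos hsum (pieceCenter hpos hsum k) : ℝ) + pieceCenter hpos hsum k = 1 := by
    rw [symExchange_apply, letter_pieceCenter]
    simp only [pieceCenter]
    ring
  have h₁ := pow_add_pow_eq_one hpos hsum hc (n := m)
    (y := symExchange hpos hsum (pieceCenter hpos hsum k)) (by rw [hm, hT]) (le_refl m)
  refine itinerary_eq_itinerary_rev hpos hsum hc ?_ j
  rw [Nat.sub_self, pow_zero, Equiv.Perm.one_apply] at h₁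
  rw [show 2 * m + 1 = m + 1 + m by ring, pow_add, Equiv.Perm.mul_apply, hm, pow_succ,
    Equiv.Perm.mul_apply]
  linarith

/-- The only palindrome of length `2 m` codes the orbit segment centred at `1/2`. -/
theorem palindromes_even (hindep : LinearIndependent ℚ α) (m : ℕ) :
    {w ∈ Set.range (itinerary hpos hsum (2 * m)) | ∀ j : Fin (2 * m), w j = w j.rev}
      = {itinerary hpos hsum (2 * m) ((symExchange hpos hsum ^ (-(m : ℤ))) center)} := by
  ext w
  rw [Set.mem_singleton_iff]
  constructor
  · rintro ⟨hw, hpal⟩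
    obtain ⟨p, x, hp, -, h⟩ := exists_midpoint_of_palindrome hpos hsum hw hpal
    have h₁ := h m (by omega)
    rw [show 2 * m - m = m by omega] at h₁
    have h₂ : (symExchange hpos hsum ^ m) p = center := Subtype.ext (by
      simp only [center]; linarith)
    rw [← hp, ← h₂, zpow_neg, zpow_natCast, Equiv.Perm.coe_inv, Equiv.symm_apply_apply]
  · rintro rfl
    exact ⟨⟨_, rfl⟩, itinerary_inv_center_rev hpos hsum hindep m⟩

/-- The palindromes of length `2 m + 1` code the orbit segments centred at the midpoints of the
exchanged intervals. -/
theorem palindromes_odd (hindep : LinearIndependent ℚ α) (m : ℕ) :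
    {w ∈ Set.range (itinerary hpos hsum (2 * m + 1)) | ∀ j : Fin (2 * m + 1), w j = w j.rev}
      = Set.range fun k => itinerary hpos hsum (2 * m + 1)
        ((symExchange hpos hsum ^ (-(m : ℤ))) (pieceCenter hpos hsum k)) := by
  ext w
  constructor
  · rintro ⟨hw, hpal⟩
    obtain ⟨p, x, hp, hx, h⟩ := exists_midpoint_of_palindrome hpos hsum hw hpal
    have h₁ := h m (by omega)
    set k := letter α hpos hsum ((symExchange hpos hsum ^ m) x) with hk
    have h₂ := symExchange_apply hpos hsum ((symExchange hpos hsum ^ m) x)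
    rw [show 2 * m + 1 - m = m + 1 by omega, pow_succ', Equiv.Perm.mul_apply, h₂, ← hk] at h₁
    have h₃ : (symExchange hpos hsum ^ m) p = pieceCenter hpos hsum k := Subtype.ext (by
      simp only [pieceCenter]; linarith)
    refine ⟨k, ?_⟩
    simp only
    rw [← hp, ← h₃, zpow_neg, zpow_natCast, Equiv.Perm.coe_inv, Equiv.symm_apply_apply]
  · rintro ⟨k, rfl⟩
    exact ⟨⟨_, rfl⟩, itinerary_inv_pieceCenter_rev hpos hsum hindep k m⟩

theorem ncard_palindromes_odd (hindep : LinearIndependent ℚ α) (m : ℕ) :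
    {w ∈ Set.range (itinerary hpos hsum (2 * m + 1)) |
      ∀ j : Fin (2 * m + 1), w j = w j.rev}.ncard = r := by
  rw [palindromes_odd hpos hsum hindep, ← Nat.card_coe_set_eq, Nat.card_range_of_injective,
    Nat.card_fin]
  -- The middle letter of the palindrome centred at the midpoint of `I_k` is `k`.
  intro k l h
  have h₁ := (itinerary_eq_iff hpos hsum).mp h m (by omega)
  rwa [zpow_neg, zpow_natCast, Equiv.Perm.coe_inv, Equiv.apply_symm_apply,
    Equiv.apply_symm_apply, letter_pieceCenter, letter_pieceCenter] at h₁

/-- The counts for any word whose factors are the itineraries of the exchange. -/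
theorem complexities_of_factors_eq (hindep : LinearIndependent ℚ α) {ι : Type*}
    [AddMonoidWithOne ι] {u : ι → Fin r}
    (hu : ∀ n, InfiniteWord.factors u n = Set.range (itinerary hpos hsum n)) :
    (∀ n : ℕ, Even n → InfiniteWord.palindromicComplexity u n = 1) ∧
      (∀ n : ℕ, Odd n → InfiniteWord.palindromicComplexity u n = r) ∧
      (∀ n : ℕ, (InfiniteWord.palindromicComplexity u n : ℤ)
          + (InfiniteWord.palindromicComplexity u (n + 1) : ℤ)
        = InfiniteWord.factorDifference u n + 2) := by
  have heven : ∀ n : ℕ, Even n → InfiniteWord.palindromicComplexity u n = 1 := by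
    rintro n hn
    obtain ⟨m, rfl⟩ := even_iff_exists_two_mul.mp hn
    rw [InfiniteWord.palindromicComplexity, hu, palindromes_even hpos hsum hindep,
      Set.ncard_singleton]
  have hodd : ∀ n : ℕ, Odd n → InfiniteWord.palindromicComplexity u n = r := by
    rintro n ⟨m, rfl⟩
    rw [InfiniteWord.palindromicComplexity, hu, ncard_palindromes_odd hpos hsum hindep]
  refine ⟨heven, hodd, fun n => ?_⟩
  have hr : 0 < r := Nat.pos_of_ne_zero fun h => by subst h; simp at hsum
  have hdiff : InfiniteWord.factorDifference u n = r - 1 := by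
    rw [InfiniteWord.factorDifference, InfiniteWord.factorComplexity,
      InfiniteWord.factorComplexity, hu, hu, ncard_range_itinerary hpos hsum hindep,
      ncard_range_itinerary hpos hsum hindep]
    push_cast [Nat.cast_sub (show 1 ≤ r from hr)]
    ring
  rw [hdiff]
  rcases Nat.even_or_odd n with hn | hn
  · rw [heven n hn, hodd (n + 1) hn.add_one]
    push_cast
    ring
  · rw [hodd n hn, heven (n + 1) hn.add_one]
    push_cast
    ring

end IntervalExchange

theorem theorem4p1 (r : ℕ) (α : Fin r → ℝ) (hpos : ∀ k, 0 < α k) (hsum : ∑ k, α k = 1)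
    (hindep : LinearIndependent ℚ α) (π : Equiv.Perm (Fin r)) (hπ : ∀ k, π k = Fin.rev k)
    (x₀ : Set.Ico (0 : ℝ) 1) (u : ℤ → Fin r)
    (hu : u = IntervalExchange.codingWord α hpos hsum π x₀)
    (v : ℕ → Fin r) (hv : ∀ n : ℕ, v n = u (n : ℤ)) :
    ((∀ n : ℕ, Even n → InfiniteWord.palindromicComplexity u n = 1) ∧
      (∀ n : ℕ, Odd n → InfiniteWord.palindromicComplexity u n = r) ∧
      (∀ n : ℕ, (InfiniteWord.palindromicComplexity u n : ℤ)
          + (InfiniteWord.palindromicComplexity u (n + 1) : ℤ)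
        = InfiniteWord.factorDifference u n + 2)) ∧
    ((∀ n : ℕ, Even n → InfiniteWord.palindromicComplexity v n = 1) ∧
      (∀ n : ℕ, Odd n → InfiniteWord.palindromicComplexity v n = r) ∧
      (∀ n : ℕ, (InfiniteWord.palindromicComplexity v n : ℤ)
          + (InfiniteWord.palindromicComplexity v (n + 1) : ℤ)
        = InfiniteWord.factorDifference v n + 2)) := by
  obtain rfl : π = Fin.revPerm := Equiv.ext hπ
  subst hu
  obtain rfl : v = fun n : ℕ => IntervalExchange.codingWord α hpos hsum Fin.revPerm x₀ n :=
    funext hv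
  exact ⟨IntervalExchange.complexities_of_factors_eq hpos hsum hindep
      (IntervalExchange.factors_codingWord hpos hsum hindep x₀),
    IntervalExchange.complexities_of_factors_eq hpos hsum hindep
      (IntervalExchange.factors_codingWord_nat hpos hsum hindep x₀)⟩
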